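/- Let $G$ be a countable discrete group and let $f=\sum_{g}f_g g\in\mathbb Z(G)$ be an element of its integral group ring. Call $f$ semi-lopsided if $f_1>0$ and $\sum_{g\ne 1}|f_g|\le f_1$, and lopsided if $\sum_{g\neq 1}|f_g|<f_1$. Let $X_f$ be the Pontryagin dual of the discrete abelian group $\mathbb Z(G)/\mathbb Z(G)f$, i.e. the compact group of its homomorphisms to $\mathbb R/\mathbb Z$, with Haar probability measure $m_{X_f}$ and with the action of $G$ given by $(g\theta)(a)=\theta(g^{-1}a)$. Assume that $f$ is semi-lopsided and put $S=\{g\in G: f_g\neq 0\}\setminus\{1\}$ and $H=\langle S\rangle$. Assume that $G$ has a left-invariant partial order $\preceq$ (that is, $x\preceq y$ implies $gx\preceq gy$) with $s\succ 1$ for all $s\in S$, and that the group $\langle a^{-1}b: a,b\in S\rangle$ is infinite. For a finite generating set $T$ of $H$ let $\gamma_T(n)=|(T\cup\{1\}\cup T^{-1})^n|$. Suppose that one of the following holds: (i) $f$ is lopsided; (ii) $H$ has superpolynomial growth, i.e. for some (equivalently, every) finite generating set $T$ of $H$ one has $n^d/\gamma_T(n)\to 0$ as $n\to\infty$ for every $d\in\mathbb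 N$; (iii) $H$ has polynomial growth of some degree $d\ge 5$, i.e. for some (equivalently, every) finite generating set $T$ of $H$ there are $c,C>0$ with $c\,n^d\le\gamma_T(n)\le C\,n^d$ for all large $n$. Then $G\curvearrowright(X_f,m_{X_f})$ is a factor of a Bernoulli shift: there are a standard probability space $(B,\beta)$ and a measurable map $\pi:B^G\to X_f$ with $\pi_*(\beta^{\otimes G})=m_{X_f}$ such that, for every $g\in G$, $\pi(gb)=g\,\pi(b)$ for $\beta^{\otimes G}$-almost every $b$, where $(gb)(h)=b(g^{-1}h)$. -/

import Mathlib

open MeasureTheory Filter Asymptotics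
open scoped Pointwise

namespace AlgebraicAction

/-! ### Principal algebraic actions -/

section Principal

variable {G : Type*} [Group G]

/-- The left `ℤ(G)`-module `ℤ(G) / ℤ(G) f`, where `ℤ(G) f` is the left ideal generated by `f`. -/
def PrincipalModule (f : MonoidAlgebra ℤ G) : Type _ :=
  MonoidAlgebra ℤ G ⧸ Submodule.span (MonoidAlgebra ℤ G) {f}

noncomputable instance (f : MonoidAlgebra ℤ G) : AddCommGroup (PrincipalModule f) :=
  inferInstanceAs (AddCommGroup (MonoidAlgebra ℤ G ⧸ Submodule.span (MonoidAlgebra ℤ G) {f}))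

noncomputable instance (f : MonoidAlgebra ℤ G) :
    Module (MonoidAlgebra ℤ G) (PrincipalModule f) :=
  inferInstanceAs
    (Module (MonoidAlgebra ℤ G) (MonoidAlgebra ℤ G ⧸ Submodule.span (MonoidAlgebra ℤ G) {f}))

/-- `ℤ(G) / ℤ(G) f` is a discrete group. -/
instance (f : MonoidAlgebra ℤ G) : TopologicalSpace (PrincipalModule f) := ⊥

instance (f : MonoidAlgebra ℤ G) : DiscreteTopology (PrincipalModule f) := ⟨rfl⟩

/-- `X_f`, the Pontryagin dual of the discrete abelian group `ℤ(G) / ℤ(G) f`: the compact group of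
continuous homomorphisms to `ℝ / ℤ`, with the compact-open topology. -/
abbrev XSpace (f : MonoidAlgebra ℤ G) : Type _ :=
  PrincipalModule f →ₜ+ UnitAddCircle

/-- The Borel sigma-algebra of `X_f`. -/
noncomputable instance (f : MonoidAlgebra ℤ G) : MeasurableSpace (XSpace f) := borel _

instance (f : MonoidAlgebra ℤ G) : BorelSpace (XSpace f) := ⟨rfl⟩

/-- The Haar probability measure `m_{X_f}` of the compact group `X_f`. -/
noncomputable def haarX (f : MonoidAlgebra ℤ G) : Measure (XSpace f) :=
  Measure.addHaarMeasure ⊤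

instance (f : MonoidAlgebra ℤ G) : (haarX f).IsAddHaarMeasure :=
  inferInstanceAs
    (Measure.addHaarMeasure (⊤ : TopologicalSpace.PositiveCompacts (XSpace f))).IsAddHaarMeasure

instance (f : MonoidAlgebra ℤ G) : IsProbabilityMeasure (haarX f) :=
  ⟨Measure.addHaarMeasure_self⟩

/-- Left translation by `g` on `ℤ(G) / ℤ(G) f`, as a continuous homomorphism. -/
noncomputable def translate (f : MonoidAlgebra ℤ G) (g : G) :
    PrincipalModule f →ₜ+ PrincipalModule f where
  toFun a := MonoidAlgebra.of ℤ G g • a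
  map_zero' := smul_zero _
  map_add' := smul_add _
  continuous_toFun := continuous_of_discreteTopology

/-- The algebraic action of `G` on `X_f`: `(g θ)(a) = θ(g⁻¹ a)`. -/
noncomputable instance (f : MonoidAlgebra ℤ G) : MulAction G (XSpace f) where
  smul g θ := θ.comp (translate f g⁻¹)
  one_smul θ := by
    apply DFunLike.ext
    intro a
    change θ (MonoidAlgebra.of ℤ G 1⁻¹ • a) = θ a
    rw [inv_one, map_one, one_smul]
  mul_smul g h θ := by
    apply DFunLike.ext
    intro a
    change θ (MonoidAlgebra.of ℤ G (g * h)⁻¹ • a) =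
      θ (MonoidAlgebra.of ℤ G h⁻¹ • MonoidAlgebra.of ℤ G g⁻¹ • a)
    rw [smul_smul, ← map_mul, mul_inv_rev]

open Classical in
/-- `f` is semi-lopsided: `f_1 > 0` and `∑_{g ≠ 1} |f_g| ≤ f_1`. -/
def IsSemiLopsided (f : MonoidAlgebra ℤ G) : Prop :=
  0 < f.coeff 1 ∧ ∑ g ∈ f.coeff.support.erase 1, |f.coeff g| ≤ f.coeff 1

open Classical in
/-- `f` is lopsided: `f_1 > ∑_{g ≠ 1} |f_g|`. -/
def IsLopsided (f : MonoidAlgebra ℤ G) : Prop :=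
  ∑ g ∈ f.coeff.support.erase 1, |f.coeff g| < f.coeff 1

/-- The support of `f` with the identity removed. -/
def offSupport (f : MonoidAlgebra ℤ G) : Set G :=
  {g | f.coeff g ≠ 0 ∧ g ≠ 1}

end Principal

/-! ### Bernoulli shifts and factors -/

section Bernoulli

/-- The underlying space `B^G` of the Bernoulli shift over `G` with base `B`. -/
def BernoulliSpace (G B : Type*) : Type _ := G → B

instance (G B : Type*) [MeasurableSpace B] : MeasurableSpace (BernoulliSpace G B) :=
  inferInstanceAs (MeasurableSpace (G → B))

/-- The shift action `(g b)(h) = b(g⁻¹ h)` of `G` on `B^G`. -/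
instance (G B : Type*) [Group G] : MulAction G (BernoulliSpace G B) where
  smul g b := fun h => b (g⁻¹ * h)
  one_smul b := by
    funext h
    change b (1⁻¹ * h) = b h
    simp
  mul_smul g₁ g₂ b := by
    funext h
    change b ((g₁ * g₂)⁻¹ * h) = b (g₂⁻¹ * (g₁⁻¹ * h))
    rw [mul_inv_rev, mul_assoc]

/-- The product measure `β^{⊗G}` on `B^G`. -/
noncomputable def bernoulliMeasure (G : Type*) {B : Type*} [MeasurableSpace B] (β : Measure B)
    [IsProbabilityMeasure β] : Measure (BernoulliSpace G B) :=
  Measure.infinitePi (fun _ : G => β)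

/-- `G ↷ (Y, ν)` is a factor of `G ↷ (X, μ)`: there is a measure-preserving map `X → Y` that is
almost surely `G`-equivariant. -/
def IsFactor (G : Type*) [Group G] {X Y : Type*} [MeasurableSpace X] [MeasurableSpace Y]
    [MulAction G X] [MulAction G Y] (μ : Measure X) (ν : Measure Y) : Prop :=
  ∃ π : X → Y, MeasurePreserving π μ ν ∧ ∀ g : G, ∀ᵐ x ∂μ, π (g • x) = g • π x

/-- `G ↷ (Y, ν)` is a factor of a Bernoulli shift over `G` whose base is a standard probability
space. -/
def IsFactorOfBernoulliShift (G : Type*) [Group G] {Y : Type*} [MeasurableSpace Y]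
    [MulAction G Y] (ν : Measure Y) : Prop :=
  ∃ (B : Type) (_ : MeasurableSpace B) (_ : StandardBorelSpace B) (β : Measure B)
    (_ : IsProbabilityMeasure β), IsFactor G (bernoulliMeasure G β) ν

end Bernoulli

/-! ### Growth of groups -/

section Growth

/-- The number of elements of the ball `(T ∪ {1} ∪ T⁻¹)^n`. -/
noncomputable def growthFunction {Γ : Type*} [Group Γ] (T : Set Γ) (n : ℕ) : ℕ :=
  ((T ∪ {1} ∪ T⁻¹) ^ n).ncard

/-- `Γ` has a finite generating set whose growth function is, up to multiplicative constants,
`n ^ d`. (Any other finite generating set then has the same property.) -/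
def HasPolynomialGrowth (Γ : Type*) [Group Γ] (d : ℝ) : Prop :=
  ∃ T : Set Γ, T.Finite ∧ Subgroup.closure T = ⊤ ∧
    (fun n : ℕ => (growthFunction T n : ℝ)) =Θ[atTop] fun n : ℕ => (n : ℝ) ^ d

/-- `Γ` has a finite generating set whose growth function grows faster than every polynomial.
(Any other finite generating set then has the same property.) -/
def HasSuperpolynomialGrowth (Γ : Type*) [Group Γ] : Prop :=
  ∃ T : Set Γ, T.Finite ∧ Subgroup.closure T = ⊤ ∧
    ∀ d : ℕ, (fun n : ℕ => (n : ℝ) ^ d) =o[atTop] fun n : ℕ => (growthFunction T n : ℝ)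

end Growth

end AlgebraicAction

/-! Write `f = 2 f_1 (1 - q)` with `q = lazyStep f`, a signed lazy random walk of `ℓ¹` norm at most
one. If `∑ ‖q ^ n‖₂ < ∞`, then `w = (2 f_1)⁻¹ ∑ q ^ n` lies in `ℓ²(G)` and inverts `f` on both
sides. In the lopsided case the sum is dominated by a geometric series. Otherwise `|q|` is dominated
by a genuine lazy walk on `H`, balls of `H` have at least a constant times `n ^ 5` elements, and a
Nash argument (`summable_norm_lazy_pow`, `summable_sqrt_of_nash`) gives summability.

Take i.i.d. bounded centred integer variables `Y(ω_g)`. For `a` in `ℤ(G)` the series `z_a = ∑ (a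
w)_g Y(ω_g)` converges in `L²`. It is additive and stationary, and `z_{af} = ∑ a_g Y(ω_g)` is an
integer, so `a ↦ z_a mod 1` is a random point of `X_f` and an equivariant factor map
(`isFactor_of_field`). Its law is Haar once the Fourier coefficient `E exp(2πi z_a)` vanishes for
every `a` outside `ℤ(G) f`. By independence this coefficient is bounded by `|φ((a w)_k)|` for each
`k`, with `φ(t) = E exp(2πi t Y)`. The law of `Y` is chosen so that `φ(t) = 0` whenever `t` is not
an integer but `f_1 t` is.

It remains to find such a coordinate (`exists_green_coeff`). Changing `a` by an element of `ℤ(G) f`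
does not change `z_a mod 1`, so `a w` may be reduced to values in `[-1/2, 1/2]`. The partial order
then supplies a `k` where `a w` is nonzero and only the leading term of the convolution equation
contributes, so `f_1 (a w)_k` is an integer (`exists_leading_coeff`). -/

namespace AlgebraicAction

/-! ### The group algebra inside `ℓ²` -/

section EllTwo

variable {G : Type*}

/-- The inclusion of the real group algebra of `G` into `ℓ²(G)`. -/
noncomputable def ell : MonoidAlgebra ℝ G →ₗ[ℝ] lp (fun _ : G => ℝ) 2 where
  toFun x := ⟨fun g => x.coeff g,
    (memℓp_zero (x.coeff.hasFiniteSupport)).of_exponent_ge (zero_le)⟩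
  map_add' _ _ := by ext; rfl
  map_smul' _ _ := by ext; rfl

@[simp] lemma ell_apply (x : MonoidAlgebra ℝ G) (g : G) : ell x g = x.coeff g := rfl

lemma norm_sq_lp_eq_tsum (v : lp (fun _ : G => ℝ) 2) : ‖v‖ ^ 2 = ∑' g, v g ^ 2 := by
  have := lp.norm_rpow_eq_tsum (p := 2) (by norm_num) v
  simpa using this

lemma norm_sq_ell (x : MonoidAlgebra ℝ G) : ‖ell x‖ ^ 2 = ∑ g ∈ x.coeff.support, x.coeff g ^ 2 := by
  rw [norm_sq_lp_eq_tsum, tsum_eq_sum (s := x.coeff.support)]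
  · rfl
  · intro g hg
    simpa using hg

/-- The `ℓ¹` norm on the real group algebra. -/
noncomputable def normOne (x : MonoidAlgebra ℝ G) : ℝ := x.coeff.sum fun _ r => |r|

lemma normOne_nonneg (x : MonoidAlgebra ℝ G) : 0 ≤ normOne x :=
  Finset.sum_nonneg fun _ _ => abs_nonneg _

lemma norm_ell_mono {x y : MonoidAlgebra ℝ G} (h : ∀ g, |x.coeff g| ≤ y.coeff g) :
    ‖ell x‖ ≤ ‖ell y‖ := by
  refine lp.norm_mono two_ne_zero fun g => ?_
  simpa using (h g).trans (le_abs_self _)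

lemma tendsto_apply_of_tendsto {v : ℕ → lp (fun _ : G => ℝ) 2} {w : lp (fun _ : G => ℝ) 2}
    (h : Tendsto v atTop (nhds w)) (g : G) : Tendsto (fun n => v n g) atTop (nhds (w g)) :=
  ((lp.lipschitzWith_one_eval (E := fun _ : G => ℝ) 2 g).continuous.tendsto w).comp h

/-- Vanishing at infinity is used twice: rounding a square-summable function gives an element of
`ℤ(G)`, and superlevel sets have minimal elements. -/
lemma finite_le_abs_lp (v : lp (fun _ : G => ℝ) 2) {ε : ℝ} (hε : 0 < ε) : {g | ε ≤ |v g|}.Finite := by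
  have h := (lp.memℓp v).summable (by norm_num)
  have h2 := h.tendsto_cofinite_zero.eventually_lt_const (show (0 : ℝ) < ε ^ 2 by positivity)
  rw [eventually_cofinite] at h2
  refine h2.subset fun g hg => ?_
  have : ε ^ 2 ≤ |v g| ^ 2 := pow_le_pow_left₀ hε.le hg 2
  simpa using this

variable [Group G]

lemma norm_ell_mul_single (x : MonoidAlgebra ℝ G) (g : G) :
    ‖ell (x * MonoidAlgebra.single g 1)‖ = ‖ell x‖ := by
  refine (sq_eq_sq₀ (norm_nonneg _) (norm_nonneg _)).1 ?_
  rw [norm_sq_lp_eq_tsum, norm_sq_lp_eq_tsum]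
  rw [← (Equiv.mulRight g⁻¹).tsum_eq (fun h => (ell x h) ^ 2)]
  simp

lemma norm_ell_single_mul (x : MonoidAlgebra ℝ G) (g : G) (r : ℝ) :
    ‖ell (MonoidAlgebra.single g r * x)‖ = |r| * ‖ell x‖ := by
  refine (sq_eq_sq₀ (norm_nonneg _) (by positivity)).1 ?_
  rw [mul_pow, norm_sq_lp_eq_tsum, norm_sq_lp_eq_tsum]
  rw [← (Equiv.mulLeft g⁻¹).tsum_eq (fun h => (ell x h) ^ 2), ← tsum_mul_left]
  simp [mul_pow]

lemma norm_ell_mul_le (x y : MonoidAlgebra ℝ G) : ‖ell (x * y)‖ ≤ normOne x * ‖ell y‖ := by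
  conv_lhs => rw [← MonoidAlgebra.sum_coeff_single x, Finsupp.sum, Finset.sum_mul, map_sum]
  refine (norm_sum_le _ _).trans ?_
  rw [normOne, Finsupp.sum, Finset.sum_mul]
  exact Finset.sum_le_sum fun g _ => (norm_ell_single_mul _ _ _).le

lemma norm_ell_pow_mul_le (x y : MonoidAlgebra ℝ G) (n : ℕ) :
    ‖ell (x ^ n * y)‖ ≤ normOne x ^ n * ‖ell y‖ := by
  induction n with
  | zero => simp
  | succ n ih =>
    rw [pow_succ', pow_succ', mul_assoc, mul_assoc]
    exact (norm_ell_mul_le _ _).trans (mul_le_mul_of_nonneg_left ih (normOne_nonneg x))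

lemma norm_ell_one : ‖ell (1 : MonoidAlgebra ℝ G)‖ = 1 := by
  have h := norm_sq_ell (1 : MonoidAlgebra ℝ G)
  rw [MonoidAlgebra.one_def, MonoidAlgebra.coeff_single, Finsupp.support_single _ one_ne_zero]
    at h
  simp only [Finset.sum_singleton, Finsupp.single_eq_same, one_pow] at h
  exact (sq_eq_sq₀ (norm_nonneg _) zero_le_one).1 (by rw [MonoidAlgebra.one_def, h, one_pow])

lemma abs_coeff_mul_le {x y x' y' : MonoidAlgebra ℝ G} (hx : ∀ g, |x.coeff g| ≤ x'.coeff g)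
    (hy : ∀ g, |y.coeff g| ≤ y'.coeff g) (g : G) : |(x * y).coeff g| ≤ (x' * y').coeff g := by
  classical
  rw [MonoidAlgebra.coeff_mul_apply_left, MonoidAlgebra.coeff_mul_apply_left]
  rw [Finsupp.sum_of_support_subset x.coeff (s := x.coeff.support ∪ x'.coeff.support)
    Finset.subset_union_left _ (by simp)]
  rw [Finsupp.sum_of_support_subset x'.coeff (s := x.coeff.support ∪ x'.coeff.support)
    Finset.subset_union_right _ (by simp)]
  refine (Finset.abs_sum_le_sum_abs _ _).trans (Finset.sum_le_sum fun h _ => ?_)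
  rw [abs_mul]
  exact mul_le_mul (hx _) (hy _) (abs_nonneg _) ((abs_nonneg _).trans (hx _))

/-- This reduces the signed walk to one with nonnegative weights: cancellation can only decrease
coefficients. -/
lemma abs_coeff_pow_le {x x' : MonoidAlgebra ℝ G} (hx : ∀ g, |x.coeff g| ≤ x'.coeff g)
    (n : ℕ) (g : G) : |(x ^ n).coeff g| ≤ (x' ^ n).coeff g := by
  induction n generalizing g with
  | zero =>
    classical
    rw [pow_zero, pow_zero, MonoidAlgebra.one_def, MonoidAlgebra.coeff_single,
      Finsupp.single_apply]
    split_ifs <;> simp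
  | succ n ih =>
    rw [pow_succ, pow_succ]
    exact abs_coeff_mul_le ih hx g

end EllTwo

/-! ### Decay of the powers of a random walk -/

section Walk

/-- A discrete form of the fact that `-a' ≥ c a ^ (7/5)` forces `√a` to be integrable. -/
lemma summable_sqrt_of_nash {a : ℕ → ℝ} {A : ℝ} (hA : 0 < A) (ha0 : ∀ n, 0 ≤ a n)
    (ha1 : ∀ n, a n ≤ 1) (hanti : ∀ n, a (n + 1) ≤ a n)
    (h : ∀ n r : ℕ, 1 ≤ r → a n ≤ A * r ^ 2 * (a n - a (n + 1)) + A / r ^ 5) :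
    Summable fun n => √(a n) := by
  -- Optimising over `r` suggests `r ≈ a ^ (-1/5)`. The tenth root makes every exponent an integer:
  -- `r ≈ b ^ (-2)` and `√a = b ^ 5`.
  set b : ℕ → ℝ := fun n => a n ^ (1 / 10 : ℝ) with hb
  have hb0 : ∀ n, 0 ≤ b n := fun n => Real.rpow_nonneg (ha0 n) _
  have hb1 : ∀ n, b n ≤ 1 := fun n => Real.rpow_le_one (ha0 n) (ha1 n) (by norm_num)
  have hb10 : ∀ n, b n ^ 10 = a n := fun n => by
    rw [hb, ← Real.rpow_natCast, ← Real.rpow_mul (ha0 n)]; norm_num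
  have hb5 : ∀ n, √(a n) = b n ^ 5 := fun n => by
    rw [← hb10, show b n ^ 10 = (b n ^ 5) ^ 2 by ring, Real.sqrt_sq (pow_nonneg (hb0 n) 5)]
  have hbanti : ∀ n, b (n + 1) ≤ b n := fun n =>
    Real.rpow_le_rpow (ha0 _) (hanti n) (by norm_num)
  set R : ℝ := 2 * A + 1 with hR
  set K : ℝ := 20 * A * (R + 1) ^ 2 with hK
  -- The telescoping bound: its right side sums to at most `K * b 0`.
  have hstep : ∀ n, b n ^ 5 ≤ K * (b n - b (n + 1)) := by
    intro n
    rcases (hb0 n).eq_or_lt with h0 | hpos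
    · have h1 : b (n + 1) = 0 := le_antisymm (h0 ▸ hbanti n) (hb0 _)
      rw [← h0, h1]; simp
    -- `R = 2A + 1` makes the tail `A / r ^ 5` at most half of `a n`, so it can be absorbed on the
    -- left.
    set r : ℕ := ⌈R / b n ^ 2⌉₊ with hr
    have hRpos : 0 < R := by positivity
    have hrpos : 1 ≤ r := Nat.one_le_iff_ne_zero.2 (Nat.ceil_pos.2 (by positivity)).ne'
    have hrlow : R / b n ^ 2 ≤ r := Nat.le_ceil _
    have hrup : (r : ℝ) ≤ (R + 1) / b n ^ 2 := by
      have h1 : (r : ℝ) < R / b n ^ 2 + 1 := Nat.ceil_lt_add_one (by positivity)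
      have h2 : 1 ≤ 1 / b n ^ 2 := by
        rw [le_div_iff₀ (by positivity), one_mul]
        exact pow_le_one₀ (hb0 n) (hb1 n)
      rw [add_div]; linarith
    have htail : A / (r : ℝ) ^ 5 ≤ b n ^ 10 / 2 := by
      have h1 : (R / b n ^ 2) ^ 5 ≤ (r : ℝ) ^ 5 := by gcongr
      have h2 : A / (r : ℝ) ^ 5 ≤ A / (R / b n ^ 2) ^ 5 := by gcongr
      have h3 : R ≤ R ^ 5 := le_self_pow₀ (by linarith) (by norm_num)
      have h4 : A / (R / b n ^ 2) ^ 5 = (A / R ^ 5) * b n ^ 10 := by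
        field_simp
      have h5 : A / R ^ 5 ≤ 1 / 2 := by
        rw [div_le_iff₀ (by positivity)]; linarith
      calc _ ≤ _ := h2
        _ = _ := h4
        _ ≤ 1 / 2 * b n ^ 10 := by gcongr
        _ = _ := by ring
    have hmain := h n r hrpos
    have hd : 0 ≤ a n - a (n + 1) := sub_nonneg.2 (hanti n)
    have hmain2 : b n ^ 10 ≤ 2 * (A * ((R + 1) / b n ^ 2) ^ 2 * (a n - a (n + 1))) := by
      have h1 : A * (r : ℝ) ^ 2 * (a n - a (n + 1)) ≤
          A * ((R + 1) / b n ^ 2) ^ 2 * (a n - a (n + 1)) := by gcongr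
      have h2 := hb10 n
      linarith
    have hdiff : a n - a (n + 1) ≤ 10 * b n ^ 9 * (b n - b (n + 1)) := by
      rw [← hb10, ← hb10]
      have hxy := hbanti n
      have hy := hb0 (n + 1)
      generalize b n = x at *
      generalize b (n + 1) = y at *
      have : x ^ 10 - y ^ 10 = (∑ i ∈ Finset.range 10, x ^ i * y ^ (10 - 1 - i)) * (x - y) :=
        (Commute.geom_sum₂_mul (Commute.all x y) 10).symm
      rw [this]
      refine mul_le_mul_of_nonneg_right ?_ (sub_nonneg.2 hxy)
      calc _ ≤ ∑ i ∈ Finset.range 10, x ^ 9 := by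
            refine Finset.sum_le_sum fun i hi => ?_
            have hi' : i ≤ 9 := by have := Finset.mem_range.1 hi; omega
            calc x ^ i * y ^ (10 - 1 - i) ≤ x ^ i * x ^ (10 - 1 - i) := by gcongr
              _ = x ^ 9 := by rw [← pow_add]; congr 1; omega
        _ = 10 * x ^ 9 := by simp
    have hfin : b n ^ 10 ≤ 2 * (A * ((R + 1) / b n ^ 2) ^ 2 *
        (10 * b n ^ 9 * (b n - b (n + 1)))) := hmain2.trans (by gcongr)
    have heq : 2 * (A * ((R + 1) / b n ^ 2) ^ 2 * (10 * b n ^ 9 * (b n - b (n + 1)))) =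
        K * (b n - b (n + 1)) * b n ^ 5 := by
      rw [hK]; field_simp; ring
    rw [heq, show b n ^ 10 = b n ^ 5 * b n ^ 5 by ring] at hfin
    exact le_of_mul_le_mul_right hfin (by positivity)
  simp_rw [hb5]
  refine summable_of_sum_range_le (c := K * b 0) (fun n => pow_nonneg (hb0 n) 5) fun n => ?_
  calc _ ≤ ∑ i ∈ Finset.range n, K * (b i - b (i + 1)) := Finset.sum_le_sum fun i _ => hstep i
    _ = K * (b 0 - b n) := by rw [← Finset.mul_sum, Finset.sum_range_sub']
    _ ≤ K * b 0 := by gcongr; linarith [hb0 n]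

variable {G : Type*} [Group G]

/-- Right translation is an isometry, so the displacement `‖x - x h‖` is subadditive in `h` and
invariant under inversion. The constant depends on `h` but not on `x`. -/
lemma exists_norm_sub_mul_single_le (S : Set G) {h : G} (hh : h ∈ Subgroup.closure S) :
    ∃ C : ℝ, 0 ≤ C ∧ ∀ (x : MonoidAlgebra ℝ G) (D : ℝ), 0 ≤ D →
      (∀ s ∈ S, ‖ell (x - x * MonoidAlgebra.single s 1)‖ ≤ D) →
      ‖ell (x - x * MonoidAlgebra.single h 1)‖ ≤ C * D := by
  induction hh using Subgroup.closure_induction with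
  | mem s hs => exact ⟨1, zero_le_one, fun x D _ h => by simpa using h s hs⟩
  | one =>
    refine ⟨0, le_rfl, fun x D _ _ => ?_⟩
    rw [← MonoidAlgebra.one_def, mul_one]
    simp
  | mul g h _ _ hg hh =>
    obtain ⟨C, hC, hg⟩ := hg
    obtain ⟨C', hC', hh⟩ := hh
    refine ⟨C + C', by positivity, fun x D hD hx => ?_⟩
    have : x - x * MonoidAlgebra.single (g * h) 1 =
        (x - x * MonoidAlgebra.single g 1) * MonoidAlgebra.single h 1 +
          (x - x * MonoidAlgebra.single h 1) := by
      rw [sub_mul, mul_assoc, MonoidAlgebra.single_mul_single, one_mul]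
      abel
    rw [this, map_add, add_mul]
    refine (norm_add_le _ _).trans (add_le_add ?_ (hh x D hD hx))
    rw [norm_ell_mul_single]
    exact hg x D hD hx
  | inv g _ hg =>
    obtain ⟨C, hC, hg⟩ := hg
    refine ⟨C, hC, fun x D hD hx => ?_⟩
    have : (x - x * MonoidAlgebra.single g⁻¹ 1) * MonoidAlgebra.single g 1 =
        -(x - x * MonoidAlgebra.single g 1) := by
      rw [sub_mul, mul_assoc, MonoidAlgebra.single_mul_single, inv_mul_cancel, one_mul,
        ← MonoidAlgebra.one_def, mul_one]
      abel
    rw [← norm_ell_mul_single _ g, this, map_neg, norm_neg]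
    exact hg x D hD hx

/-- Subadditivity makes the displacement linear in the radius. The finite set `T` is unrelated to
`S`; a common constant for its elements suffices. -/
lemma exists_norm_sub_mul_single_le_of_mem_pow (S : Set G) {T : Set (Subgroup.closure S)}
    (hT : T.Finite) :
    ∃ C : ℝ, 0 ≤ C ∧ ∀ (n : ℕ), ∀ h ∈ (T ∪ {1} ∪ T⁻¹) ^ n, ∀ (x : MonoidAlgebra ℝ G) (D : ℝ),
      0 ≤ D → (∀ s ∈ S, ‖ell (x - x * MonoidAlgebra.single s 1)‖ ≤ D) →
      ‖ell (x - x * MonoidAlgebra.single (h : G) 1)‖ ≤ n * C * D := by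
  have hfin : (T ∪ {1} ∪ T⁻¹).Finite := (hT.union (Set.finite_singleton _)).union hT.inv
  choose c hc0 hc using fun h : Subgroup.closure S => exists_norm_sub_mul_single_le S h.2
  obtain ⟨C, hC⟩ := (hfin.image c).bddAbove
  have hC' : ∀ h ∈ T ∪ {1} ∪ T⁻¹, c h ≤ C := fun h hh => hC (Set.mem_image_of_mem c hh)
  have hC0 : 0 ≤ C := (hc0 1).trans (hC' 1 (by simp))
  refine ⟨C, hC0, fun n => ?_⟩
  induction n with
  | zero =>
    intro h hh x D hD hx
    rw [pow_zero, Set.mem_one] at hh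
    rw [hh, Subgroup.coe_one, ← MonoidAlgebra.one_def, mul_one]
    simp
  | succ n ih =>
    intro h hh x D hD hx
    rw [pow_succ, Set.mem_mul] at hh
    obtain ⟨g, hg, k, hk, rfl⟩ := hh
    have : x - x * MonoidAlgebra.single ((g * k : Subgroup.closure S) : G) 1 =
        (x - x * MonoidAlgebra.single (g : G) 1) * MonoidAlgebra.single (k : G) 1 +
          (x - x * MonoidAlgebra.single (k : G) 1) := by
      rw [sub_mul, mul_assoc, MonoidAlgebra.single_mul_single, one_mul, Subgroup.coe_mul]
      abel
    rw [this, map_add]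
    refine (norm_add_le _ _).trans ?_
    rw [norm_ell_mul_single]
    have h1 := ih g hg x D hD hx
    have h2 := (hc k x D hD hx).trans (mul_le_mul_of_nonneg_right (hC' k hk) hD)
    push_cast
    linarith

/-- Compare `x` with its average over right translates by `B`. That average is `x * 1_B / |B|`, of
norm at most `|B| ^ (-1/2)` because left convolution by `x` contracts `ℓ²`. -/
lemma norm_ell_le_of_average (B : Finset G) (hB : B.Nonempty) (x : MonoidAlgebra ℝ G)
    (hx : ∀ y, ‖ell (x * y)‖ ≤ ‖ell y‖) {E : ℝ}
    (hE : ∀ h ∈ B, ‖ell (x - x * MonoidAlgebra.single h 1)‖ ≤ E) :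
    ‖ell x‖ ≤ E + 1 / √(B.card : ℝ) := by
  classical
  have hcard : (0 : ℝ) < B.card := by exact_mod_cast hB.card_pos
  set y : MonoidAlgebra ℝ G := ∑ h ∈ B, MonoidAlgebra.single h (1 : ℝ) with hy
  have hycoeff : ∀ g, y.coeff g = if g ∈ B then 1 else 0 := by
    intro g
    rw [hy, MonoidAlgebra.coeff_sum, Finsupp.finsetSum_apply]
    simp [Finsupp.single_apply]
  have hynorm : ‖ell y‖ = √(B.card : ℝ) := by
    rw [← Real.sqrt_sq (norm_nonneg (ell y)), norm_sq_lp_eq_tsum, tsum_eq_sum (s := B)]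
    · simp [hycoeff]
    · intro g hg
      simp [hycoeff, hg]
  have hsplit : (B.card : ℝ) • x = ∑ h ∈ B, (x - x * MonoidAlgebra.single h 1) + x * y := by
    rw [Finset.sum_sub_distrib, hy, Finset.mul_sum]
    simp [Nat.cast_smul_eq_nsmul]
  have h1 : (B.card : ℝ) * ‖ell x‖ ≤ B.card * E + √(B.card : ℝ) := by
    calc (B.card : ℝ) * ‖ell x‖ = ‖ell ((B.card : ℝ) • x)‖ := by
          rw [map_smul, norm_smul]; simp
      _ ≤ ∑ h ∈ B, ‖ell (x - x * MonoidAlgebra.single h 1)‖ + ‖ell (x * y)‖ := by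
          rw [hsplit, map_add, map_sum]
          exact (norm_add_le _ _).trans (add_le_add_left (norm_sum_le _ _) _)
      _ ≤ ∑ h ∈ B, E + ‖ell y‖ := add_le_add (Finset.sum_le_sum hE) (hx y)
      _ = _ := by rw [hynorm]; simp
  have h2 : √(B.card : ℝ) = B.card * (1 / √(B.card : ℝ)) := by
    rw [mul_one_div, Real.div_sqrt]
  rw [h2, ← mul_add] at h1
  exact le_of_mul_le_mul_left h1 hcard

/-- Laziness replaces reversibility. By the parallelogram law the midpoint of `x` and `x s` loses a
quarter of `‖x - x s‖ ^ 2`, and convexity of the square averages this over `s`; `m` need not be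
symmetric. -/
lemma norm_sq_ell_mul_lazy_le (S : Finset G) (m : G → ℝ) (hm : ∀ s ∈ S, 0 ≤ m s)
    (hsum : ∑ s ∈ S, m s = 1) (x : MonoidAlgebra ℝ G) :
    ‖ell (x * ((1 / 2 : ℝ) • (1 + ∑ s ∈ S, MonoidAlgebra.single s (m s))))‖ ^ 2 ≤
      ‖ell x‖ ^ 2 - 1 / 4 * ∑ s ∈ S, m s * ‖ell (x - x * MonoidAlgebra.single s 1)‖ ^ 2 := by
  have hx : x * ((1 / 2 : ℝ) • (1 + ∑ s ∈ S, MonoidAlgebra.single s (m s))) =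
      ∑ s ∈ S, m s • ((1 / 2 : ℝ) • (x + x * MonoidAlgebra.single s 1)) := by
    simp_rw [smul_comm (m _) (1 / 2 : ℝ)]
    rw [← Finset.smul_sum, mul_smul_comm]
    congr 1
    simp_rw [smul_add]
    rw [Finset.sum_add_distrib, ← Finset.sum_smul, hsum, one_smul, mul_add, mul_one,
      Finset.mul_sum]
    congr 1
    refine Finset.sum_congr rfl fun s _ => ?_
    rw [← mul_smul_comm, MonoidAlgebra.smul_single, smul_eq_mul, mul_one]
  have hpar : ∀ s, ‖ell ((1 / 2 : ℝ) • (x + x * MonoidAlgebra.single s 1))‖ ^ 2 =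
      ‖ell x‖ ^ 2 - 1 / 4 * ‖ell (x - x * MonoidAlgebra.single s 1)‖ ^ 2 := by
    intro s
    have h := parallelogram_law_with_norm ℝ (ell x) (ell (x * MonoidAlgebra.single s 1))
    rw [norm_ell_mul_single] at h
    rw [map_smul, norm_smul, map_add, map_sub, mul_pow]
    norm_num
    linarith
  rw [hx, map_sum]
  calc _ ≤ (∑ s ∈ S, m s * ‖ell ((1 / 2 : ℝ) • (x + x * MonoidAlgebra.single s 1))‖) ^ 2 := by
        gcongr
        refine (norm_sum_le _ _).trans (Finset.sum_le_sum fun s hs => ?_)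
        rw [map_smul, norm_smul, Real.norm_of_nonneg (hm s hs)]
    _ ≤ ∑ s ∈ S, m s * ‖ell ((1 / 2 : ℝ) • (x + x * MonoidAlgebra.single s 1))‖ ^ 2 :=
        Real.pow_arith_mean_le_arith_mean_pow S _ _ hm hsum (fun _ _ => norm_nonneg _) 2
    _ = _ := by
        simp_rw [hpar, mul_sub]
        rw [Finset.sum_sub_distrib, ← Finset.sum_mul, hsum, one_mul, Finset.mul_sum]
        congr 1
        exact Finset.sum_congr rfl fun s _ => by ring

end Walk

/-! ### Growth of balls and summability of the lazy walk -/

section Walk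

lemma finite_pow {Γ : Type*} [Monoid Γ] {U : Set Γ} (hU : U.Finite) (n : ℕ) : (U ^ n).Finite := by
  induction n with
  | zero => simp
  | succ n ih => rw [pow_succ]; exact ih.mul hU

lemma growthFunction_pos {Γ : Type*} [Group Γ] {T : Set Γ} (hT : T.Finite) (n : ℕ) :
    0 < growthFunction T n := by
  have hfin : (T ∪ {1} ∪ T⁻¹).Finite := (hT.union (Set.finite_singleton _)).union hT.inv
  rw [growthFunction, Set.ncard_pos (finite_pow hfin n)]
  exact ⟨1, by simpa using Set.pow_mem_pow (n := n) (show (1 : Γ) ∈ T ∪ {1} ∪ T⁻¹ by simp)⟩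

lemma exists_pow_five_le_of_isBigO {Γ : Type*} [Group Γ] {T : Set Γ} (hT : T.Finite)
    (h : (fun n : ℕ => (n : ℝ) ^ 5) =O[atTop] fun n : ℕ => (growthFunction T n : ℝ)) :
    ∃ K : ℝ, 0 < K ∧ ∀ n : ℕ, (n : ℝ) ^ 5 ≤ K * growthFunction T n := by
  obtain ⟨c, hc, h⟩ := h.exists_pos
  obtain ⟨N, hN⟩ := eventually_atTop.1 h.bound
  -- The extra `N ^ 5` covers `n ≤ N`, since balls have at least one element.
  refine ⟨c + (N : ℝ) ^ 5, by positivity, fun n => ?_⟩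
  have h1 : (1 : ℝ) ≤ growthFunction T n := by exact_mod_cast growthFunction_pos hT n
  rcases le_total N n with hn | hn
  · have := hN n hn
    rw [Real.norm_of_nonneg (by positivity), Real.norm_of_nonneg (by positivity)] at this
    rw [add_mul]
    have : 0 ≤ (N : ℝ) ^ 5 * growthFunction T n := by positivity
    linarith
  · have h2 : (n : ℝ) ^ 5 ≤ (N : ℝ) ^ 5 := by gcongr
    calc (n : ℝ) ^ 5 ≤ (c + (N : ℝ) ^ 5) * 1 := by linarith
      _ ≤ _ := by gcongr

lemma HasSuperpolynomialGrowth.exists_pow_five_le {Γ : Type*} [Group Γ]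
    (h : HasSuperpolynomialGrowth Γ) :
    ∃ T : Set Γ, T.Finite ∧ ∃ K : ℝ, 0 < K ∧ ∀ n : ℕ, (n : ℝ) ^ 5 ≤ K * growthFunction T n := by
  obtain ⟨T, hT, -, h⟩ := h
  exact ⟨T, hT, exists_pow_five_le_of_isBigO hT (h 5).isBigO⟩

lemma HasPolynomialGrowth.exists_pow_five_le {Γ : Type*} [Group Γ] {d : ℝ} (hd : 5 ≤ d)
    (h : HasPolynomialGrowth Γ d) :
    ∃ T : Set Γ, T.Finite ∧ ∃ K : ℝ, 0 < K ∧ ∀ n : ℕ, (n : ℝ) ^ 5 ≤ K * growthFunction T n := by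
  obtain ⟨T, hT, -, h⟩ := h
  refine ⟨T, hT, exists_pow_five_le_of_isBigO hT (IsBigO.trans ?_ h.2)⟩
  refine IsBigO.of_bound 1 (eventually_atTop.2 ⟨1, fun n hn => ?_⟩)
  have hn' : (1 : ℝ) ≤ n := by exact_mod_cast hn
  rw [Real.norm_of_nonneg (by positivity), Real.norm_of_nonneg (by positivity), one_mul,
    ← Real.rpow_natCast]
  exact Real.rpow_le_rpow_of_exponent_le hn' (by exact_mod_cast hd)

variable {G : Type*} [Group G]

lemma norm_ell_lazy_mul_le (S : Finset G) (m : G → ℝ) (hm : ∀ s ∈ S, 0 ≤ m s)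
    (hsum : ∑ s ∈ S, m s = 1) (y : MonoidAlgebra ℝ G) :
    ‖ell (((1 / 2 : ℝ) • (1 + ∑ s ∈ S, MonoidAlgebra.single s (m s))) * y)‖ ≤ ‖ell y‖ := by
  rw [smul_mul_assoc, add_mul, one_mul, Finset.sum_mul, map_smul, norm_smul, map_add, map_sum]
  have h : ‖∑ s ∈ S, ell (MonoidAlgebra.single s (m s) * y)‖ ≤ ‖ell y‖ := by
    calc _ ≤ ∑ s ∈ S, m s * ‖ell y‖ := (norm_sum_le _ _).trans <| Finset.sum_le_sum fun s hs => by
            rw [norm_ell_single_mul, abs_of_nonneg (hm s hs)]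
      _ = _ := by rw [← Finset.sum_mul, hsum, one_mul]
  have h2 := (norm_add_le (ell y) (∑ s ∈ S, ell (MonoidAlgebra.single s (m s) * y)))
  norm_num
  linarith

/-- Nash's method: displacement by generators is controlled by the energy loss `a n - a (n + 1)`,
hence displacement over the ball of radius `r` by `r` times its square root. Averaging over that
ball adds an error of order `r ^ (-5/2)`. The resulting decay of `a n` makes its square root
summable. -/
theorem summable_norm_lazy_pow (S : Finset G) (m : G → ℝ) (hm : ∀ s ∈ S, 0 < m s)
    (hsum : ∑ s ∈ S, m s = 1) {T : Set (Subgroup.closure (S : Set G))} (hT : T.Finite) {K : ℝ}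
    (hK : 0 < K) (hgrowth : ∀ n : ℕ, (n : ℝ) ^ 5 ≤ K * growthFunction T n) :
    Summable fun n : ℕ =>
      ‖ell (((1 / 2 : ℝ) • (1 + ∑ s ∈ S, MonoidAlgebra.single s (m s))) ^ n)‖ := by
  classical
  set q : MonoidAlgebra ℝ G := (1 / 2 : ℝ) • (1 + ∑ s ∈ S, MonoidAlgebra.single s (m s)) with hq
  have hm' : ∀ s ∈ S, 0 ≤ m s := fun s hs => (hm s hs).le
  have hqpow : ∀ (n : ℕ) (y : MonoidAlgebra ℝ G), ‖ell (q ^ n * y)‖ ≤ ‖ell y‖ := by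
    intro n
    induction n with
    | zero => intro y; simp
    | succ n ih =>
      intro y
      rw [pow_succ, mul_assoc]
      exact (ih _).trans (norm_ell_lazy_mul_le S m hm' hsum y)
  set a : ℕ → ℝ := fun n => ‖ell (q ^ n)‖ ^ 2 with ha
  have henergy : ∀ n, 1 / 4 * ∑ s ∈ S, m s *
      ‖ell (q ^ n - q ^ n * MonoidAlgebra.single s 1)‖ ^ 2 ≤ a n - a (n + 1) := fun n => by
    have := norm_sq_ell_mul_lazy_le S m hm' hsum (q ^ n)
    rw [← hq, ← pow_succ] at this
    simp only [ha]
    linarith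
  have hanti : ∀ n, a (n + 1) ≤ a n := fun n => by
    have h := henergy n
    have : 0 ≤ ∑ s ∈ S, m s * ‖ell (q ^ n - q ^ n * MonoidAlgebra.single s 1)‖ ^ 2 :=
      Finset.sum_nonneg fun s hs => mul_nonneg (hm' s hs) (sq_nonneg _)
    linarith
  have ha0 : ∀ n, 0 ≤ a n := fun n => sq_nonneg _
  have ha1 : ∀ n, a n ≤ 1 := fun n => by
    have := hqpow n 1
    rw [mul_one, norm_ell_one] at this
    exact pow_le_one₀ (norm_nonneg _) this
  obtain ⟨δ, hδ, hmδ⟩ : ∃ δ : ℝ, 0 < δ ∧ ∀ s ∈ S, δ ≤ m s := by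
    have hne : S.Nonempty := by
      rw [Finset.nonempty_iff_ne_empty]
      rintro rfl
      simp at hsum
    obtain ⟨s, hs, hmin⟩ := S.exists_min_image m hne
    exact ⟨m s, hm s hs, hmin⟩
  obtain ⟨C, hC, hball⟩ := exists_norm_sub_mul_single_le_of_mem_pow (S : Set G) hT
  have hfin : (T ∪ {1} ∪ T⁻¹).Finite := (hT.union (Set.finite_singleton _)).union hT.inv
  have hsqrt : ∀ n, √(a n) = ‖ell (q ^ n)‖ := fun n => Real.sqrt_sq (norm_nonneg _)
  simp_rw [← hsqrt]
  -- The constant comes from `(u + v) ^ 2 ≤ 2 (u ^ 2 + v ^ 2)` with `u = r C D`, `D ^ 2 = (4 / δ) (a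
  -- n - a (n + 1))` and `v ^ 2 ≤ K / r ^ 5`.
  refine summable_sqrt_of_nash (A := 8 * C ^ 2 / δ + 2 * K) (by positivity) ha0 ha1 hanti
    fun n r hr => ?_
  have hr' : (0 : ℝ) < r := by exact_mod_cast hr
  have hΔ : 0 ≤ a n - a (n + 1) := sub_nonneg.2 (hanti n)
  set D : ℝ := √(4 / δ * (a n - a (n + 1))) with hD
  have hD2 : D ^ 2 = 4 / δ * (a n - a (n + 1)) := Real.sq_sqrt (by positivity)
  have hDs : ∀ s ∈ (S : Set G), ‖ell (q ^ n - q ^ n * MonoidAlgebra.single s 1)‖ ≤ D := by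
    intro s hs
    refine Real.le_sqrt_of_sq_le ?_
    have h1 : m s * ‖ell (q ^ n - q ^ n * MonoidAlgebra.single s 1)‖ ^ 2 ≤
        ∑ s ∈ S, m s * ‖ell (q ^ n - q ^ n * MonoidAlgebra.single s 1)‖ ^ 2 :=
      Finset.single_le_sum (f := fun s => m s * ‖ell (q ^ n - q ^ n * MonoidAlgebra.single s 1)‖ ^ 2)
        (fun s hs => mul_nonneg (hm' s hs) (sq_nonneg _)) hs
    have h2 : δ * ‖ell (q ^ n - q ^ n * MonoidAlgebra.single s 1)‖ ^ 2 ≤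
        m s * ‖ell (q ^ n - q ^ n * MonoidAlgebra.single s 1)‖ ^ 2 := by
      gcongr
      exact hmδ s hs
    have h3 := henergy n
    rw [div_mul_eq_mul_div, le_div_iff₀ hδ]
    linarith
  set B : Finset G := (finite_pow hfin r).toFinset.image Subtype.val with hB
  have hBcard : B.card = growthFunction T r := by
    rw [hB, Finset.card_image_of_injective _ Subtype.val_injective, growthFunction,
      Set.ncard_eq_toFinset_card _ (finite_pow hfin r)]
  have hγ : (0 : ℝ) < growthFunction T r := by exact_mod_cast growthFunction_pos hT r
  have hmain := norm_ell_le_of_average B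
    (Finset.card_pos.1 (hBcard ▸ growthFunction_pos hT r)) (q ^ n) (hqpow n) (E := r * C * D) (by
      intro h hh
      rw [hB, Finset.mem_image] at hh
      obtain ⟨h, hh, rfl⟩ := hh
      exact hball r h (by simpa using hh) (q ^ n) D (Real.sqrt_nonneg _) hDs)
  rw [hBcard] at hmain
  have h1 : a n ≤ 2 * ((r * C * D) ^ 2 + (1 / √(growthFunction T r : ℝ)) ^ 2) :=
    (pow_le_pow_left₀ (norm_nonneg _) hmain 2).trans add_sq_le
  rw [div_pow, Real.sq_sqrt hγ.le, mul_pow, mul_pow, hD2, one_pow] at h1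
  have h2 : 1 / (growthFunction T r : ℝ) ≤ K / r ^ 5 := by
    rw [div_le_div_iff₀ hγ (by positivity), one_mul]
    exact hgrowth r
  have h3 : 0 ≤ 2 * K * (r : ℝ) ^ 2 * (a n - a (n + 1)) := by positivity
  have h4 : 0 ≤ 8 * C ^ 2 / δ / (r : ℝ) ^ 5 := by positivity
  calc a n ≤ 8 * C ^ 2 / δ * r ^ 2 * (a n - a (n + 1)) + 2 * (K / r ^ 5) := by
        refine h1.trans ?_
        rw [mul_add]
        refine add_le_add (le_of_eq (by ring)) (by linarith)
    _ ≤ _ := by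
        rw [add_mul, add_mul, add_div, mul_div_assoc 2 K]
        linarith

end Walk

/-! ### The homoclinic point -/

section Green

variable {G : Type*} [Group G]

/-- The inclusion of the integral group ring into the real group algebra. -/
noncomputable def toReal : MonoidAlgebra ℤ G →+* MonoidAlgebra ℝ G :=
  MonoidAlgebra.mapRingHom G (Int.castRingHom ℝ)

@[simp] lemma coeff_toReal (a : MonoidAlgebra ℤ G) (g : G) : (toReal a).coeff g = a.coeff g :=
  MonoidAlgebra.coeff_mapRingHom _ _ _

/-- The element `1 - f / (2 f_1)`: the (signed) lazy random walk attached to `f`. -/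
noncomputable def lazyStep (f : MonoidAlgebra ℤ G) : MonoidAlgebra ℝ G :=
  1 - (1 / (2 * (f.coeff 1 : ℝ))) • toReal f

lemma smul_one_sub_lazyStep {f : MonoidAlgebra ℤ G} (hf : 0 < f.coeff 1) :
    (2 * (f.coeff 1 : ℝ)) • (1 - lazyStep f) = toReal f := by
  have : (0 : ℝ) < f.coeff 1 := by exact_mod_cast hf
  rw [lazyStep, sub_sub_cancel, smul_smul, mul_one_div_cancel (by positivity), one_smul]

lemma coeff_lazyStep_one {f : MonoidAlgebra ℤ G} (hf : 0 < f.coeff 1) :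
    (lazyStep f).coeff 1 = 1 / 2 := by
  have : (0 : ℝ) < f.coeff 1 := by exact_mod_cast hf
  simp only [lazyStep, MonoidAlgebra.coeff_sub, Finsupp.sub_apply, MonoidAlgebra.coeff_one_one,
    MonoidAlgebra.coeff_smul, Finsupp.smul_apply, coeff_toReal, smul_eq_mul]
  field_simp
  norm_num

lemma coeff_lazyStep_of_ne (f : MonoidAlgebra ℤ G) {g : G} (hg : g ≠ 1) :
    (lazyStep f).coeff g = -(f.coeff g / (2 * f.coeff 1)) := by
  simp only [lazyStep, MonoidAlgebra.coeff_sub, Finsupp.sub_apply, MonoidAlgebra.one_def,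
    MonoidAlgebra.coeff_single, MonoidAlgebra.coeff_smul, Finsupp.smul_apply, coeff_toReal,
    smul_eq_mul, Finsupp.single_eq_of_ne hg]
  ring

-- The lazy half at the identity plus half of a ratio smaller than one gives `ℓ¹` norm below one,
-- hence geometric decay.
open Classical in
lemma IsLopsided.summable_norm_lazyStep_pow {f : MonoidAlgebra ℤ G} (hf : 0 < f.coeff 1)
    (h : IsLopsided f) : Summable fun n => ‖ell (lazyStep f ^ n)‖ := by
  have hM : (0 : ℝ) < f.coeff 1 := by exact_mod_cast hf
  have hlt : normOne (lazyStep f) < 1 := by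
    have h1 : (1 : G) ∈ f.coeff.support := by simpa using hf.ne'
    have hsub : (lazyStep f).coeff.support ⊆ f.coeff.support := by
      intro g hg
      by_contra hgf
      have hg1 : g ≠ 1 := fun h => hgf (h ▸ h1)
      rw [Finsupp.mem_support_iff, coeff_lazyStep_of_ne f hg1] at hg
      rw [Finsupp.mem_support_iff, not_not] at hgf
      exact hg (by simp [hgf])
    rw [normOne, Finsupp.sum_of_support_subset _ hsub _ (by simp),
      ← Finset.add_sum_erase _ _ h1, coeff_lazyStep_one hf]
    have h2 : ∑ g ∈ f.coeff.support.erase 1, |(lazyStep f).coeff g| =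
        ((∑ g ∈ f.coeff.support.erase 1, |f.coeff g| : ℤ) : ℝ) / (2 * f.coeff 1) := by
      push_cast
      rw [Finset.sum_div]
      refine Finset.sum_congr rfl fun g hg => ?_
      rw [coeff_lazyStep_of_ne f (Finset.ne_of_mem_erase hg), abs_neg, abs_div,
        abs_of_pos (by positivity : (0 : ℝ) < 2 * f.coeff 1)]
    rw [h2]
    have h3 : ((∑ g ∈ f.coeff.support.erase 1, |f.coeff g| : ℤ) : ℝ) < f.coeff 1 := by
      exact_mod_cast h
    have h4 : ((∑ g ∈ f.coeff.support.erase 1, |f.coeff g| : ℤ) : ℝ) / (2 * f.coeff 1) < 1 / 2 := by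
      rw [div_lt_iff₀ (by positivity)]
      linarith
    rw [abs_of_pos (by norm_num)]
    linarith
  refine Summable.of_nonneg_of_le (fun _ => norm_nonneg _) (fun n => ?_)
    (summable_geometric_of_lt_one (normOne_nonneg _) hlt)
  simpa [norm_ell_one] using norm_ell_pow_mul_le (lazyStep f) 1 n

open Classical in
lemma coe_support_erase_one (f : MonoidAlgebra ℤ G) :
    (f.coeff.support.erase 1 : Set G) = offSupport f := by
  ext g
  simp [offSupport]

-- If `f` is not lopsided, the weights `|f_s| / f_1` sum to exactly one, so the lazy walk they
-- define is stochastic and dominates `lazyStep f`.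
open Classical in
lemma summable_norm_lazyStep_pow_of_growth {f : MonoidAlgebra ℤ G} (hf : IsSemiLopsided f)
    (h : ∃ T : Set (Subgroup.closure (offSupport f)), T.Finite ∧ ∃ K : ℝ, 0 < K ∧
      ∀ n : ℕ, (n : ℝ) ^ 5 ≤ K * growthFunction T n) :
    Summable fun n => ‖ell (lazyStep f ^ n)‖ := by
  by_cases hlop : IsLopsided f
  · exact hlop.summable_norm_lazyStep_pow hf.1
  have hM : (0 : ℝ) < f.coeff 1 := by exact_mod_cast hf.1
  have hsum : ∑ g ∈ f.coeff.support.erase 1, |f.coeff g| = f.coeff 1 :=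
    le_antisymm hf.2 (not_lt.1 hlop)
  rw [← coe_support_erase_one] at h
  obtain ⟨T, hT, K, hK, hgr⟩ := h
  refine Summable.of_nonneg_of_le (fun _ => norm_nonneg _) (fun n => norm_ell_mono
    (abs_coeff_pow_le (fun g => ?_) n))
    (summable_norm_lazy_pow (f.coeff.support.erase 1) (fun g => |(f.coeff g : ℝ)| / f.coeff 1)
      (fun s hs => ?_) ?_ hT hK hgr)
  · rw [MonoidAlgebra.coeff_smul, Finsupp.smul_apply, MonoidAlgebra.coeff_add, Finsupp.add_apply,
      MonoidAlgebra.coeff_sum, Finsupp.finsetSum_apply]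
    simp only [MonoidAlgebra.one_def, MonoidAlgebra.coeff_single, Finsupp.single_apply,
      smul_eq_mul]
    by_cases hg : g = 1
    · subst hg
      rw [coeff_lazyStep_one hf.1]
      simp
    · rw [coeff_lazyStep_of_ne f hg, abs_neg, abs_div,
        abs_of_pos (by positivity : (0 : ℝ) < 2 * f.coeff 1)]
      by_cases hg0 : f.coeff g = 0
      · simp [hg0, Ne.symm hg]
      · rw [Finset.sum_ite_eq' _ g, if_pos (Finset.mem_erase.2 ⟨hg, Finsupp.mem_support_iff.2 hg0⟩),
          if_neg (Ne.symm hg)]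
        apply le_of_eq
        field_simp
        ring
  · have : (f.coeff s : ℝ) ≠ 0 := by simpa using Finset.mem_of_mem_erase hs
    positivity
  · rw [← Finset.sum_div, div_eq_one_iff_eq hM.ne']
    exact_mod_cast hsum

/-- The truncations of the convolution of `a` with the fundamental solution of `f`. -/
noncomputable def greenTrunc (f a : MonoidAlgebra ℤ G) (N : ℕ) : MonoidAlgebra ℝ G :=
  (1 / (2 * (f.coeff 1 : ℝ))) • ∑ n ∈ Finset.range N, toReal a * lazyStep f ^ n

/-- The convolution of `a` with the fundamental solution of `f`. -/
noncomputable def green (f a : MonoidAlgebra ℤ G) : lp (fun _ : G => ℝ) 2 :=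
  (1 / (2 * (f.coeff 1 : ℝ))) • ∑' n, ell (toReal a * lazyStep f ^ n)

lemma summable_norm_mul_lazyStep_pow {f : MonoidAlgebra ℤ G}
    (hs : Summable fun n => ‖ell (lazyStep f ^ n)‖) (x : MonoidAlgebra ℝ G) :
    Summable fun n => ‖ell (x * lazyStep f ^ n)‖ :=
  Summable.of_nonneg_of_le (fun _ => norm_nonneg _) (fun _ => norm_ell_mul_le _ _)
    (hs.mul_left (normOne x))

lemma tendsto_ell_greenTrunc {f : MonoidAlgebra ℤ G}
    (hs : Summable fun n => ‖ell (lazyStep f ^ n)‖) (a : MonoidAlgebra ℤ G) :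
    Tendsto (fun N => ell (greenTrunc f a N)) atTop (nhds (green f a)) := by
  simp only [greenTrunc, map_smul, map_sum]
  exact ((summable_norm_mul_lazyStep_pow hs (toReal a)).of_norm.hasSum.tendsto_sum_nat).const_smul _

lemma tendsto_ell_mul_one_sub_lazyStep_pow {f : MonoidAlgebra ℤ G}
    (hs : Summable fun n => ‖ell (lazyStep f ^ n)‖) (x : MonoidAlgebra ℝ G) :
    Tendsto (fun N => ell (x * (1 - lazyStep f ^ N))) atTop (nhds (ell x)) := by
  have h := (summable_norm_mul_lazyStep_pow hs x).of_norm.tendsto_atTop_zero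
  have h2 := (tendsto_const_nhds (x := ell x)).sub h
  rw [sub_zero] at h2
  simpa only [mul_sub, mul_one, map_sub] using h2

lemma greenTrunc_mul {f : MonoidAlgebra ℤ G} (hf : 0 < f.coeff 1) (a : MonoidAlgebra ℤ G) (N : ℕ) :
    greenTrunc f a N * toReal f = toReal a * (1 - lazyStep f ^ N) := by
  have hM : (0 : ℝ) < f.coeff 1 := by exact_mod_cast hf
  rw [← smul_one_sub_lazyStep hf, greenTrunc, ← Finset.mul_sum, smul_mul_smul_comm,
    one_div_mul_cancel (by positivity), one_smul, mul_assoc, geom_sum_mul_neg]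

lemma greenTrunc_mul_right {f : MonoidAlgebra ℤ G} (hf : 0 < f.coeff 1) (a : MonoidAlgebra ℤ G)
    (N : ℕ) : greenTrunc f (a * f) N = toReal a * (1 - lazyStep f ^ N) := by
  have hM : (0 : ℝ) < f.coeff 1 := by exact_mod_cast hf
  rw [greenTrunc, ← Finset.mul_sum, map_mul, ← smul_one_sub_lazyStep hf, mul_smul_comm,
    smul_mul_assoc, smul_smul, one_div_mul_cancel (by positivity), one_smul, mul_assoc,
    mul_neg_geom_sum]

lemma greenTrunc_add (f a b : MonoidAlgebra ℤ G) (N : ℕ) :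
    greenTrunc f (a + b) N = greenTrunc f a N + greenTrunc f b N := by
  simp only [greenTrunc, map_add, add_mul, Finset.sum_add_distrib, smul_add]

lemma greenTrunc_sub (f a b : MonoidAlgebra ℤ G) (N : ℕ) :
    greenTrunc f (a - b) N = greenTrunc f a N - greenTrunc f b N := by
  simp only [greenTrunc, map_sub, sub_mul, Finset.sum_sub_distrib, smul_sub]

lemma greenTrunc_single_mul (f a : MonoidAlgebra ℤ G) (g : G) (N : ℕ) :
    greenTrunc f (MonoidAlgebra.single g 1 * a) N =
      MonoidAlgebra.single g 1 * greenTrunc f a N := by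
  have : toReal (MonoidAlgebra.single g 1 : MonoidAlgebra ℤ G) = MonoidAlgebra.single g 1 := by
    rw [toReal, MonoidAlgebra.mapRingHom_single]; simp
  simp only [greenTrunc, map_mul, this, mul_smul_comm, Finset.mul_sum, mul_assoc]

lemma green_sub {f : MonoidAlgebra ℤ G}
    (hs : Summable fun n => ‖ell (lazyStep f ^ n)‖) (a b : MonoidAlgebra ℤ G) :
    green f (a - b) = green f a - green f b := by
  refine tendsto_nhds_unique (tendsto_ell_greenTrunc hs _) ?_
  simp only [greenTrunc_sub, map_sub]
  exact (tendsto_ell_greenTrunc hs a).sub (tendsto_ell_greenTrunc hs b)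

lemma green_mul {f : MonoidAlgebra ℤ G} (hf : 0 < f.coeff 1)
    (hs : Summable fun n => ‖ell (lazyStep f ^ n)‖) (a : MonoidAlgebra ℤ G) :
    green f (a * f) = ell (toReal a) := by
  refine tendsto_nhds_unique (tendsto_ell_greenTrunc hs _) ?_
  simp only [greenTrunc_mul_right hf]
  exact tendsto_ell_mul_one_sub_lazyStep_pow hs _

/-- The equation `(a w) f = a` in coordinates. As `f` has finite support it passes to the limit
pointwise. Together with `green_mul` this uses that the fundamental solution is a two-sided inverse.
-/
lemma sum_green_mul {f : MonoidAlgebra ℤ G} (hf : 0 < f.coeff 1)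
    (hs : Summable fun n => ‖ell (lazyStep f ^ n)‖) (a : MonoidAlgebra ℤ G) (k : G) :
    ∑ h ∈ f.coeff.support, green f a (k * h⁻¹) * f.coeff h = a.coeff k := by
  have h1 := tendsto_apply_of_tendsto
    (tendsto_ell_mul_one_sub_lazyStep_pow hs (toReal a)) k
  simp only [← greenTrunc_mul hf, ell_apply, coeff_toReal] at h1
  refine tendsto_nhds_unique ?_ h1
  have hsupp : (toReal f).coeff.support ⊆ f.coeff.support := by
    intro g
    simp
  simp_rw [MonoidAlgebra.coeff_mul_apply_right]
  simp_rw [Finsupp.sum_of_support_subset (toReal f).coeff hsupp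
    (fun (h : G) (r : ℝ) => (greenTrunc f a _).coeff (k * h⁻¹) * r) (by simp), coeff_toReal]
  exact tendsto_finsetSum _ fun h _ =>
    (tendsto_apply_of_tendsto (tendsto_ell_greenTrunc hs a) (k * h⁻¹)).mul_const _

open Classical in
/-- A minimality argument for the partial order: a nonzero solution, vanishing at infinity, of the
convolution equation `v f = a` is nonzero at a point where only the leading term contributes. -/
lemma exists_leading_coeff [PartialOrder G] (hleft : ∀ g x y : G, x ≤ y → g * x ≤ g * y)
    {f : MonoidAlgebra ℤ G} (hf : IsSemiLopsided f) (hpos : ∀ s ∈ offSupport f, 1 < s)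
    (a : MonoidAlgebra ℤ G) (v : G → ℝ) (hv : ∀ ε > 0, {g | ε ≤ |v g|}.Finite)
    (hconv : ∀ k, ∑ h ∈ f.coeff.support, v (k * h⁻¹) * f.coeff h = a.coeff k) (hv0 : ∃ k, v k ≠ 0) :
    ∃ k, v k ≠ 0 ∧ f.coeff 1 * v k = a.coeff k := by
  have hM : (0 : ℝ) < f.coeff 1 := by exact_mod_cast hf.1
  have hconv' : ∀ k, f.coeff 1 * v k +
      ∑ s ∈ f.coeff.support.erase 1, v (k * s⁻¹) * f.coeff s = a.coeff k := by
    intro k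
    have h1 : (1 : G) ∈ f.coeff.support := by simpa using hf.1.ne'
    rw [← hconv k, ← Finset.add_sum_erase _ _ h1, inv_one, mul_one, mul_comm]
  have hlt : ∀ k, ∀ s ∈ f.coeff.support.erase 1, k * s⁻¹ < k := by
    intro k s hs
    have hs1 : 1 < s := hpos s (by rw [← coe_support_erase_one]; exact hs)
    have h1 : k * s⁻¹ ≤ k := by simpa using hleft (k * s⁻¹) 1 s hs1.le
    refine lt_of_le_of_ne h1 fun h => hs1.ne' ?_
    simpa using h
  by_contra hcon
  push Not at hcon
  -- Under the contrary assumption the support of `v` has no lowest point: each of its elements has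
  -- a strictly smaller one of the form `k * s⁻¹`.
  have hdown : ∀ k, v k ≠ 0 → ∃ s ∈ f.coeff.support.erase 1, v (k * s⁻¹) ≠ 0 := by
    intro k hk
    by_contra hall
    push Not at hall
    refine hcon k hk ?_
    rw [← hconv' k, Finset.sum_eq_zero fun s hs => by rw [hall s hs, zero_mul], add_zero]
  -- Minimising a natural number needs no well-foundedness of the order on `G`. At a minimiser `k₀`,
  -- the support of `a` is avoided by every point of the support of `v` below `k₀`, since descending
  -- past a common point would lower the count.
  let c : G → ℕ := fun k => (a.coeff.support.filter (· ≤ k)).card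
  obtain ⟨k₀, hk₀, hmin⟩ : ∃ k₀, v k₀ ≠ 0 ∧ ∀ j, v j ≠ 0 → c k₀ ≤ c j := by
    have hne : ({k | v k ≠ 0} : Set G).Nonempty := hv0
    exact ⟨Function.argminOn c _ hne, Function.argminOn_mem c _ hne,
      fun j hj => Function.argminOn_le c _ hj⟩
  have ha : ∀ j, v j ≠ 0 → j ≤ k₀ → a.coeff j = 0 := by
    intro j hj hjk
    by_contra haj
    obtain ⟨s, hs, hjs⟩ := hdown j hj
    have hlt' := hlt j s hs
    refine (hmin _ hjs).not_gt (Finset.card_lt_card ?_)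
    refine Finset.ssubset_iff_of_subset (fun m hm => ?_) |>.2 ⟨j, ?_, ?_⟩
    · rw [Finset.mem_filter] at hm ⊢
      exact ⟨hm.1, hm.2.trans (hlt'.le.trans hjk)⟩
    · simp [haj, hjk]
    · simp [hlt'.not_ge]
  have hF : {j | j ≤ k₀ ∧ |v k₀| ≤ |v j|}.Finite :=
    (hv |v k₀| (abs_pos.2 hk₀)).subset fun j hj => hj.2
  -- Below `k₀` the equation is homogeneous on the support of `v`. At a minimal `j` all `|v (j *
  -- s⁻¹)|` are strictly smaller than `|v j|`, contradicting the semi-lopsided bound as in a maximum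
  -- principle.
  obtain ⟨j, hj⟩ := hF.exists_minimal ⟨k₀, le_rfl, le_rfl⟩
  have hvj : 0 < |v j| := (abs_pos.2 hk₀).trans_le hj.1.2
  have hsmall : ∀ s ∈ f.coeff.support.erase 1, |v (j * s⁻¹)| < |v j| := by
    intro s hs
    by_contra hbig
    push Not at hbig
    exact hj.not_lt (y := j * s⁻¹) ⟨(hlt j s hs).le.trans hj.1.1, hj.1.2.trans hbig⟩ (hlt j s hs)
  have heq := hconv' j
  rw [ha j (abs_pos.1 hvj) hj.1.1, Int.cast_zero, add_eq_zero_iff_eq_neg] at heq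
  have h1 : f.coeff 1 * |v j| ≤ ∑ s ∈ f.coeff.support.erase 1, |v (j * s⁻¹)| * |(f.coeff s : ℝ)| := by
    rw [← abs_of_pos hM, ← abs_mul, heq, abs_neg]
    exact (Finset.abs_sum_le_sum_abs _ _).trans (le_of_eq (by simp [abs_mul]))
  have hsemi : ∑ s ∈ f.coeff.support.erase 1, |(f.coeff s : ℝ)| ≤ f.coeff 1 := by
    exact_mod_cast hf.2
  -- Strictness of the sum needs a summand; with none, the equation reads `f_1 v_j = 0`.
  rcases (f.coeff.support.erase 1).eq_empty_or_nonempty with hempty | hne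
  · rw [hempty, Finset.sum_empty] at h1
    exact absurd h1 (mul_pos hM hvj).not_ge
  · have h2 : ∑ s ∈ f.coeff.support.erase 1, |v (j * s⁻¹)| * |(f.coeff s : ℝ)| <
        ∑ s ∈ f.coeff.support.erase 1, |v j| * |(f.coeff s : ℝ)| := by
      refine Finset.sum_lt_sum_of_nonempty hne fun s hs => ?_
      have : (f.coeff s : ℝ) ≠ 0 := by simpa using Finset.mem_of_mem_erase hs
      exact mul_lt_mul_of_pos_right (hsmall s hs) (abs_pos.2 this)
    rw [← Finset.mul_sum] at h2
    have h3 : |v j| * ∑ s ∈ f.coeff.support.erase 1, |(f.coeff s : ℝ)| ≤ |v j| * f.coeff 1 := by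
      gcongr
    linarith [mul_comm |v j| (f.coeff 1 : ℝ)]

/-- Subtracting the rounding `b` of `a w` leaves values in `[-1/2, 1/2]`, where nonzero means
non-integral. The remainder is not identically zero, as otherwise the convolution equation would
give `a = b * f`. -/
lemma exists_green_coeff [PartialOrder G] (hleft : ∀ g x y : G, x ≤ y → g * x ≤ g * y)
    {f : MonoidAlgebra ℤ G} (hf : IsSemiLopsided f) (hpos : ∀ s ∈ offSupport f, 1 < s)
    (hs : Summable fun n => ‖ell (lazyStep f ^ n)‖) (a : MonoidAlgebra ℤ G)
    (ha : ∀ b, b * f ≠ a) :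
    ∃ (b : MonoidAlgebra ℤ G) (k : G) (m : ℤ), f.coeff 1 * green f (a - b * f) k = m ∧
      ∀ n : ℤ, green f (a - b * f) k ≠ n := by
  have hround : ∀ x : ℝ, round x ≠ 0 → 1 / 2 ≤ |x| := by
    intro x hx
    by_contra h
    push Not at h
    rw [abs_lt] at h
    exact hx (round_eq_zero_iff.2 ⟨by linarith, by linarith⟩)
  let b : MonoidAlgebra ℤ G := .ofCoeff (Finsupp.onFinset
    (finite_le_abs_lp (green f a) one_half_pos).toFinset (fun k => round (green f a k))
    (fun k hk => by simpa using hround _ hk))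
  have hb : ∀ k, b.coeff k = round (green f a k) := fun k => rfl
  have hval : ∀ k, green f (a - b * f) k = green f a k - round (green f a k) := by
    intro k
    rw [green_sub hs, green_mul hf.1 hs, lp.coeFn_sub, Pi.sub_apply, ell_apply, coeff_toReal, hb]
  obtain ⟨k, hk, hkM⟩ := exists_leading_coeff hleft hf hpos (a - b * f) (green f (a - b * f))
    (fun ε hε => finite_le_abs_lp _ hε) (sum_green_mul hf.1 hs _) (by
      by_contra hzero
      push Not at hzero
      refine ha b (sub_eq_zero.1 ?_).symm
      ext k
      have h := sum_green_mul hf.1 hs (a - b * f) k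
      rw [Finset.sum_eq_zero fun h _ => by rw [hzero, zero_mul]] at h
      exact_mod_cast h.symm)
  refine ⟨b, k, _, hkM, fun n hn => ?_⟩
  have h1 : |(n : ℝ)| ≤ 1 / 2 := by
    rw [← hn, hval]
    exact abs_sub_round _
  have h2 : n = 0 := by
    have : |(n : ℝ)| < 1 := h1.trans_lt (by norm_num)
    exact Int.abs_lt_one_iff.1 (by exact_mod_cast this)
  rw [h2, Int.cast_zero] at hn
  exact hk hn

end Green

/-! ### Linear statistics of an i.i.d. field -/

section CircleChar

/-- The standard character of `ℝ / ℤ`, with values in `ℂ`. -/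
noncomputable def circleChar (t : UnitAddCircle) : ℂ := AddCircle.toCircle t

lemma circleChar_add (s t : UnitAddCircle) : circleChar (s + t) = circleChar s * circleChar t := by
  simp [circleChar, AddCircle.toCircle_add]

@[simp] lemma circleChar_zero : circleChar 0 = 1 := by simp [circleChar]

lemma circleChar_neg (t : UnitAddCircle) : circleChar (-t) = star (circleChar t) := by
  rw [circleChar, AddCircle.toCircle_neg, Circle.coe_inv_eq_conj]
  rfl

@[simp] lemma norm_circleChar (t : UnitAddCircle) : ‖circleChar t‖ = 1 := Circle.norm_coe _

lemma continuous_circleChar : Continuous circleChar :=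
  continuous_subtype_val.comp AddCircle.continuous_toCircle

lemma circleChar_injective : Function.Injective circleChar :=
  Subtype.val_injective.comp (AddCircle.injective_toCircle one_ne_zero)

lemma circleChar_nsmul (n : ℕ) (t : UnitAddCircle) : circleChar (n • t) = circleChar t ^ n := by
  simp [circleChar, AddCircle.toCircle_nsmul]

lemma circleChar_sum {ι : Type*} (s : Finset ι) (t : ι → UnitAddCircle) :
    circleChar (∑ i ∈ s, t i) = ∏ i ∈ s, circleChar (t i) := by
  classical
  induction s using Finset.induction_on with
  | empty => simp
  | insert i s hi ih => rw [Finset.sum_insert hi, Finset.prod_insert hi, circleChar_add, ih]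

lemma intCast_unitAddCircle_eq_zero (n : ℤ) : ((n : ℝ) : UnitAddCircle) = 0 :=
  AddCircle.coe_eq_zero_iff 1 |>.2 ⟨n, by simp⟩

/-- A centred integer-valued distribution whose characteristic function vanishes at the nontrivial
`M`-torsion points of the circle. -/
lemma exists_vanishing_distribution (M : ℕ) (hM : 0 < M) :
    ∃ (B : Type) (_ : MeasurableSpace B) (_ : StandardBorelSpace B) (β : Measure B)
      (_ : IsProbabilityMeasure β) (Y : B → ℤ) (C : ℝ), Measurable Y ∧ (∀ b, |(Y b : ℝ)| ≤ C) ∧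
      ∫ b, (Y b : ℝ) ∂β = 0 ∧ ∀ t : ℝ, (∃ m : ℤ, M * t = m) → (∀ n : ℤ, t ≠ n) →
        ∫ b, circleChar ((t * Y b : ℝ) : UnitAddCircle) ∂β = 0 := by
  have : NeZero M := ⟨hM.ne'⟩
  have hmeas : ∀ f : Fin M × Fin M → ℤ, Measurable f := fun f => measurable_of_countable f
  -- The difference of two independent uniform variables on `{0, …, M - 1}`: one factor of its
  -- characteristic function is a full geometric sum, and the difference centres it while keeping
  -- integer values.
  refine ⟨Fin M × Fin M, inferInstance, inferInstance,
    (PMF.uniformOfFintype (Fin M × Fin M)).toMeasure, inferInstance,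
    fun b => (b.1 : ℤ) - b.2, 2 * M, hmeas _, fun b => ?_, ?_, ?_⟩
  · have h1 : ((b.1 : ℕ) : ℝ) ≤ M := by exact_mod_cast b.1.2.le
    have h2 : ((b.2 : ℕ) : ℝ) ≤ M := by exact_mod_cast b.2.2.le
    have h3 : (0 : ℝ) ≤ ((b.1 : ℕ) : ℝ) := by positivity
    have h4 : (0 : ℝ) ≤ ((b.2 : ℕ) : ℝ) := by positivity
    push_cast
    rw [abs_le]
    constructor <;> linarith
  · rw [PMF.integral_eq_sum]
    simp only [PMF.uniformOfFintype_apply]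
    rw [← Finset.smul_sum, Fintype.sum_prod_type]
    push_cast
    simp only [Finset.sum_sub_distrib]
    simp [← Finset.mul_sum]
  · rintro t ⟨m, hm⟩ ht
    rw [PMF.integral_eq_sum]
    simp only [PMF.uniformOfFintype_apply]
    rw [← Finset.smul_sum, Fintype.sum_prod_type]
    have hterm : ∀ i j : Fin M, circleChar ((t * (((i : ℕ) : ℤ) - ((j : ℕ) : ℤ) : ℤ) : ℝ) :
        UnitAddCircle) = circleChar (t : UnitAddCircle) ^ (i : ℕ) *
          circleChar (-((j : ℕ) • (t : UnitAddCircle))) := by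
      intro i j
      rw [← circleChar_nsmul, ← circleChar_add]
      congr 1
      rw [← AddCircle.coe_nsmul, ← AddCircle.coe_nsmul, ← AddCircle.coe_neg, ← AddCircle.coe_add]
      congr 1
      push_cast
      simp only [nsmul_eq_mul]
      ring
    have hgeom : ∑ i : Fin M, circleChar (t : UnitAddCircle) ^ (i : ℕ) = 0 := by
      rw [Fin.sum_univ_eq_sum_range (fun i => circleChar (t : UnitAddCircle) ^ i)]
      have h1 : circleChar (t : UnitAddCircle) ≠ 1 := by
        intro h
        rw [← circleChar_zero] at h
        obtain ⟨n, hn⟩ := (AddCircle.coe_eq_zero_iff 1).1 (circleChar_injective h)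
        exact ht n (by simpa using hn.symm)
      rw [geom_sum_eq h1, ← circleChar_nsmul, ← AddCircle.coe_nsmul, nsmul_eq_mul, hm,
        intCast_unitAddCircle_eq_zero]
      simp
    simp_rw [hterm, ← Finset.mul_sum]
    rw [← Finset.sum_mul, hgeom]
    simp

end CircleChar

/-! ### Variance and characteristic functions of linear statistics -/

section Field

instance (G : Type*) {B : Type*} [MeasurableSpace B] (β : Measure B) [IsProbabilityMeasure β] :
    IsProbabilityMeasure (bernoulliMeasure G β) :=
  inferInstanceAs (IsProbabilityMeasure (Measure.infinitePi (fun _ : G => β)))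

variable {G B : Type*}

/-- The linear statistic `∑ g, x_g Y(ω_g)` of a configuration `ω`. -/
noncomputable def linStat (Y : B → ℤ) (x : MonoidAlgebra ℝ G) (ω : BernoulliSpace G B) : ℝ :=
  x.coeff.sum fun g r => r * Y (ω g)

lemma linStat_sub (Y : B → ℤ) (x y : MonoidAlgebra ℝ G) (ω : BernoulliSpace G B) :
    linStat Y (x - y) ω = linStat Y x ω - linStat Y y ω := by
  simp only [linStat, MonoidAlgebra.coeff_sub]
  exact Finsupp.sum_sub_index fun g r s => by ring

lemma linStat_add (Y : B → ℤ) (x y : MonoidAlgebra ℝ G) (ω : BernoulliSpace G B) :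
    linStat Y (x + y) ω = linStat Y x ω + linStat Y y ω := by
  simp only [linStat, MonoidAlgebra.coeff_add]
  exact Finsupp.sum_add_index' (fun g => by ring) fun g r s => by ring

lemma linStat_smul [Group G] (Y : B → ℤ) (x : MonoidAlgebra ℝ G) (h : G)
    (ω : BernoulliSpace G B) :
    linStat Y x (h • ω) = linStat Y (MonoidAlgebra.single h⁻¹ 1 * x) ω := by
  induction x using MonoidAlgebra.induction_linear with
  | zero => simp [linStat]
  | add x y hx hy => rw [linStat_add, mul_add, linStat_add, hx, hy]
  | single g r =>
    rw [MonoidAlgebra.single_mul_single]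
    simp only [linStat, MonoidAlgebra.coeff_single, one_mul, Finsupp.sum_single_index, zero_mul]
    rfl

lemma exists_linStat_toReal_eq_intCast [Group G] (Y : B → ℤ) (a : MonoidAlgebra ℤ G)
    (ω : BernoulliSpace G B) : ∃ n : ℤ, linStat Y (toReal a) ω = n := by
  refine ⟨a.coeff.sum fun g r => r * Y (ω g), ?_⟩
  rw [linStat, Finsupp.sum_of_support_subset (toReal a).coeff (s := a.coeff.support) ?_ _ (by simp)]
  · simp [Finsupp.sum]
  · intro g
    simp

variable [MeasurableSpace B]

lemma measurable_eval_bernoulli (g : G) : Measurable fun ω : BernoulliSpace G B => ω g :=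
  measurable_pi_apply g

lemma measurable_linStat {Y : B → ℤ} (hY : Measurable Y) (x : MonoidAlgebra ℝ G) :
    Measurable (linStat Y x) :=
  Finset.measurable_fun_sum _ fun g _ =>
    ((measurable_from_top (f := fun n : ℤ => (n : ℝ))).comp
      (hY.comp (measurable_eval_bernoulli g))).const_mul _

variable {β : Measure B} [IsProbabilityMeasure β]

lemma measurePreserving_eval_bernoulli (g : G) :
    MeasurePreserving (fun ω : BernoulliSpace G B => ω g) (bernoulliMeasure G β) β :=
  measurePreserving_eval_infinitePi (fun _ : G => β) g

lemma integral_eval_bernoulli {E : Type*} [NormedAddCommGroup E] [NormedSpace ℝ E] (g : G)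
    {φ : B → E} (hφ : AEStronglyMeasurable φ β) :
    ∫ ω, φ (ω g) ∂(bernoulliMeasure G β) = ∫ b, φ b ∂β := by
  have h := measurePreserving_eval_bernoulli (β := β) g
  conv_rhs => rw [← h.map_eq]
  exact (integral_map h.aemeasurable (h.map_eq.symm ▸ hφ)).symm

lemma measurePreserving_smul_bernoulli [Group G] (h : G) :
    MeasurePreserving (fun ω : BernoulliSpace G B => h • ω) (bernoulliMeasure G β)
      (bernoulliMeasure G β) :=
  ⟨measurable_pi_lambda _ fun g => measurable_eval_bernoulli (h⁻¹ * g),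
    Measure.map_infinitePi_infinitePi_of_inj (P := fun _ : G => β) (mul_right_injective h⁻¹)⟩

lemma iIndepFun_bernoulli {E : Type*} [MeasurableSpace E] {X : G → B → E}
    (hX : ∀ g, Measurable (X g)) :
    ProbabilityTheory.iIndepFun (fun g (ω : BernoulliSpace G B) => X g (ω g))
      (bernoulliMeasure G β) :=
  ProbabilityTheory.iIndepFun_infinitePi (P := fun _ : G => β) hX

variable {Y : B → ℤ} {C : ℝ}

lemma memLp_linStat (hY : Measurable Y) (hC : ∀ b, |(Y b : ℝ)| ≤ C) (x : MonoidAlgebra ℝ G) :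
    MemLp (linStat Y x) 2 (bernoulliMeasure G β) := by
  refine MemLp.of_bound (measurable_linStat hY x).aestronglyMeasurable (normOne x * C)
    (Eventually.of_forall fun ω => ?_)
  rw [linStat, normOne, Finsupp.sum, Finsupp.sum, Finset.sum_mul]
  refine (norm_sum_le _ _).trans (Finset.sum_le_sum fun g _ => ?_)
  rw [norm_mul]
  exact mul_le_mul_of_nonneg_left (hC _) (abs_nonneg _)

/-- Centred independent summands are orthogonal. This turns `ℓ²` convergence of coefficients into
`L²` convergence of statistics. -/
lemma integral_linStat_sq_le (hY : Measurable Y) (hC : ∀ b, |(Y b : ℝ)| ≤ C)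
    (hY0 : ∫ b, (Y b : ℝ) ∂β = 0) (x : MonoidAlgebra ℝ G) :
    ∫ ω, linStat Y x ω ^ 2 ∂(bernoulliMeasure G β) ≤ C ^ 2 * ‖ell x‖ ^ 2 := by
  have hYr : Measurable fun b => (Y b : ℝ) :=
    (measurable_from_top (f := fun n : ℤ => (n : ℝ))).comp hY
  let X : G → BernoulliSpace G B → ℝ := fun g ω => x.coeff g * Y (ω g)
  have hXm : ∀ g, Measurable (X g) := fun g =>
    (hYr.comp (measurable_eval_bernoulli g)).const_mul _
  have hXb : ∀ g ω, ‖X g ω‖ ≤ |x.coeff g| * C := fun g ω => by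
    rw [norm_mul]
    exact mul_le_mul_of_nonneg_left (hC _) (abs_nonneg _)
  have hXL : ∀ g, MemLp (X g) 2 (bernoulliMeasure G β) := fun g =>
    MemLp.of_bound (hXm g).aestronglyMeasurable _ (Eventually.of_forall (hXb g))
  have hX0 : ∀ g, ∫ ω, X g ω ∂(bernoulliMeasure G β) = 0 := fun g => by
    have := integral_eval_bernoulli (β := β) g (φ := fun b => (Y b : ℝ))
      hYr.aestronglyMeasurable
    rw [integral_const_mul, this, hY0, mul_zero]
  have hsum : (∑ g ∈ x.coeff.support, X g) = linStat Y x := by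
    ext ω
    simp [linStat, Finsupp.sum, X]
  have hind : ProbabilityTheory.iIndepFun X (bernoulliMeasure G β) :=
    iIndepFun_bernoulli (X := fun g b => x.coeff g * (Y b : ℝ)) fun g => hYr.const_mul _
  have hvar := ProbabilityTheory.IndepFun.variance_sum (X := X) (s := x.coeff.support)
    (fun g _ => hXL g) (fun g _ h _ hgh => hind.indepFun hgh)
  rw [hsum, ProbabilityTheory.variance_of_integral_eq_zero
    (measurable_linStat hY x).aemeasurable] at hvar
  · rw [hvar, norm_sq_ell, Finset.mul_sum]
    refine Finset.sum_le_sum fun g _ => ?_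
    rw [ProbabilityTheory.variance_of_integral_eq_zero (hXm g).aemeasurable (hX0 g)]
    calc ∫ ω, X g ω ^ 2 ∂(bernoulliMeasure G β)
        ≤ ∫ _, C ^ 2 * x.coeff g ^ 2 ∂(bernoulliMeasure G β) := by
          refine integral_mono (hXL g).integrable_sq (integrable_const _) fun ω => ?_
          have := pow_le_pow_left₀ (norm_nonneg _) (hXb g ω) 2
          rw [mul_pow, sq_abs, Real.norm_eq_abs, sq_abs] at this
          linarith
      _ = _ := by simp
  · rw [← hsum]
    simp only [Finset.sum_apply]
    rw [integral_finsetSum _ fun g _ => (hXL g).integrable one_le_two]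
    exact Finset.sum_eq_zero fun g _ => hX0 g

/-- `linStat` as an element of `L²`. -/
noncomputable def linStatLp (hY : Measurable Y) (hC : ∀ b, |(Y b : ℝ)| ≤ C)
    (x : MonoidAlgebra ℝ G) : Lp ℝ 2 (bernoulliMeasure G β) :=
  (memLp_linStat hY hC x).toLp _

lemma norm_linStatLp_sub_le (hY : Measurable Y) (hC : ∀ b, |(Y b : ℝ)| ≤ C)
    (hY0 : ∫ b, (Y b : ℝ) ∂β = 0) (x y : MonoidAlgebra ℝ G) :
    ‖linStatLp (β := β) hY hC x - linStatLp hY hC y‖ ≤ |C| * ‖ell x - ell y‖ := by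
  have h : linStatLp (β := β) hY hC x - linStatLp hY hC y =
      (memLp_linStat hY hC (x - y)).toLp _ := by
    rw [linStatLp, linStatLp, ← MemLp.toLp_sub]
    exact MemLp.toLp_congr _ _ (Eventually.of_forall fun ω => (linStat_sub Y x y ω).symm)
  rw [h, ← map_sub]
  refine (sq_le_sq₀ (norm_nonneg _) (by positivity)).1 ?_
  rw [mul_pow, sq_abs]
  refine le_trans (le_of_eq ?_) (integral_linStat_sq_le hY hC hY0 (x - y))
  rw [← real_inner_self_eq_norm_sq, L2.inner_def]
  refine integral_congr_ae ?_
  filter_upwards [(memLp_linStat hY hC (x - y)).coeFn_toLp] with ω hω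
  rw [hω, real_inner_self_eq_norm_sq, Real.norm_eq_abs, sq_abs]

/-- The characteristic function of a sum of independent variables is a product of factors of modulus
at most one. Keeping a single factor gives a bound that survives the passage to infinite sums. -/
lemma norm_integral_circleChar_linStat_le (hY : Measurable Y) (x : MonoidAlgebra ℝ G) (k : G) :
    ‖∫ ω, circleChar (linStat Y x ω : UnitAddCircle) ∂(bernoulliMeasure G β)‖ ≤
      ‖∫ b, circleChar ((x.coeff k * Y b : ℝ) : UnitAddCircle) ∂β‖ := by
  classical
  have hYr : Measurable fun b => (Y b : ℝ) :=
    (measurable_from_top (f := fun n : ℤ => (n : ℝ))).comp hY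
  let X : G → B → ℂ := fun g b => circleChar ((x.coeff g * Y b : ℝ) : UnitAddCircle)
  have hX : ∀ g, Measurable (X g) := fun g =>
    continuous_circleChar.measurable.comp
      ((AddCircle.continuous_mk' 1).measurable.comp (hYr.const_mul _))
  -- Inserting `k` ensures that its factor occurs even when `x` vanishes there.
  set s : Finset G := insert k x.coeff.support with hs
  have hind : ProbabilityTheory.iIndepFun (fun (g : s) (ω : BernoulliSpace G B) => X g (ω g))
      (bernoulliMeasure G β) :=
    (iIndepFun_bernoulli hX).precomp (g := fun g : s => (g : G)) Subtype.val_injective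
  have hprod : ∀ ω, circleChar (linStat Y x ω : UnitAddCircle) = ∏ g : s, X g (ω g) := by
    intro ω
    rw [linStat, Finsupp.sum_of_support_subset x.coeff (Finset.subset_insert k _) _ (by simp),
      ← hs, Finset.prod_coe_sort s (fun g => X g (ω g)), ← circleChar_sum]
    congr 1
    exact map_sum (QuotientAddGroup.mk' (AddSubgroup.zmultiples (1 : ℝ))) _ _
  have hint : ∀ g, ∫ ω, X g (ω g) ∂(bernoulliMeasure G β) = ∫ b, X g b ∂β := fun g =>
    integral_eval_bernoulli (β := β) g (φ := X g)
      (hX g).aestronglyMeasurable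
  simp_rw [hprod]
  rw [hind.integral_fun_prod_eq_prod_integral fun g =>
    ((hX g).comp (measurable_eval_bernoulli (g : G))).aestronglyMeasurable, norm_prod]
  simp_rw [hint]
  have hle : ∀ g, ‖∫ b, X g b ∂β‖ ≤ 1 := fun g =>
    (norm_integral_le_of_norm_le_const (C := 1) (Eventually.of_forall fun b => by simp [X])).trans
      (by simp)
  rw [Finset.prod_coe_sort s (fun g => ‖∫ b, X g b ∂β‖),
    ← Finset.mul_prod_erase s _ (Finset.mem_insert_self k _)]
  exact mul_le_of_le_one_right (norm_nonneg _)
    (Finset.prod_le_one (fun _ _ => norm_nonneg _) fun g _ => hle g)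

end Field

/-! ### The compact group `X_f` -/

section XSpace

variable {G : Type*} [Group G]

/-- The projection of `ℤ(G)` onto `ℤ(G) / ℤ(G) f`. -/
noncomputable def toPrincipal (f a : MonoidAlgebra ℤ G) : PrincipalModule f :=
  Submodule.Quotient.mk (p := Submodule.span (MonoidAlgebra ℤ G) {f}) a

lemma toPrincipal_surjective (f : MonoidAlgebra ℤ G) : Function.Surjective (toPrincipal f) :=
  Submodule.Quotient.mk_surjective _

lemma toPrincipal_eq_zero_iff (f a : MonoidAlgebra ℤ G) :
    toPrincipal f a = 0 ↔ ∃ b, b * f = a :=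
  (Submodule.Quotient.mk_eq_zero _).trans Submodule.mem_span_singleton

lemma smul_apply_toPrincipal (f : MonoidAlgebra ℤ G) (g : G) (θ : XSpace f)
    (a : MonoidAlgebra ℤ G) :
    (g • θ) (toPrincipal f a) = θ (toPrincipal f (MonoidAlgebra.single g⁻¹ 1 * a)) := rfl

lemma XSpace.ext_toPrincipal {f : MonoidAlgebra ℤ G} {θ θ' : XSpace f}
    (h : ∀ a, θ (toPrincipal f a) = θ' (toPrincipal f a)) : θ = θ' := by
  refine DFunLike.ext _ _ fun q => ?_
  obtain ⟨a, rfl⟩ := toPrincipal_surjective f q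
  exact h a

lemma exists_XSpace_of_forall_mul_eq_zero {f : MonoidAlgebra ℤ G}
    (e : MonoidAlgebra ℤ G →+ UnitAddCircle) (he : ∀ a, e (a * f) = 0) :
    ∃ θ : XSpace f, ∀ a, θ (toPrincipal f a) = e a := by
  let θ : PrincipalModule f →+ UnitAddCircle :=
    QuotientAddGroup.lift (Submodule.span (MonoidAlgebra ℤ G) {f}).toAddSubgroup e (by
      intro x hx
      obtain ⟨b, rfl⟩ := Submodule.mem_span_singleton.1 hx
      exact he b)
  exact ⟨⟨θ, continuous_of_discreteTopology⟩, fun a => rfl⟩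

/-- The character of `X_f` given by an element of `ℤ(G) / ℤ(G) f`. -/
noncomputable def dualChar {f : MonoidAlgebra ℤ G} (q : PrincipalModule f) :
    BoundedContinuousFunction (XSpace f) ℂ :=
  BoundedContinuousFunction.mkOfCompact
    ⟨fun θ => circleChar (θ q), continuous_circleChar.comp (ContinuousEvalConst.continuous_eval_const q)⟩

lemma dualChar_apply {f : MonoidAlgebra ℤ G} (q : PrincipalModule f) (θ : XSpace f) :
    dualChar q θ = circleChar (θ q) := rfl

open Algebra in
/-- The star subalgebra of trigonometric polynomials on `X_f`. -/
noncomputable def trigPoly (f : MonoidAlgebra ℤ G) :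
    StarSubalgebra ℂ (BoundedContinuousFunction (XSpace f) ℂ) where
  toSubalgebra := adjoin ℂ (Set.range dualChar)
  star_mem' := by
    change adjoin ℂ (Set.range (dualChar (f := f))) ≤ star (adjoin ℂ (Set.range (dualChar (f := f))))
    refine adjoin_le ?_
    rintro - ⟨q, rfl⟩
    refine subset_adjoin ⟨-q, ?_⟩
    ext θ
    simp [dualChar_apply, circleChar_neg]

/-- Products of characters are characters, so identities of integrals need only be checked on single
characters. -/
lemma trigPoly_toSubmodule (f : MonoidAlgebra ℤ G) :
    Subalgebra.toSubmodule (trigPoly f).toSubalgebra =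
      Submodule.span ℂ (Set.range (dualChar (f := f))) := by
  apply Algebra.adjoin_eq_span_of_subset
  refine Set.Subset.trans ?_ Submodule.subset_span
  intro x hx
  refine Submonoid.closure_induction (fun _ => id) ⟨0, ?_⟩ ?_ hx
  · ext θ; simp [dualChar_apply]
  · rintro - - - - ⟨q, rfl⟩ ⟨r, rfl⟩
    refine ⟨q + r, ?_⟩
    ext θ
    simp [dualChar_apply, circleChar_add]

instance [Countable G] : Countable (MonoidAlgebra ℤ G) :=
  MonoidAlgebra.coeff_injective.countable

instance [Countable G] (f : MonoidAlgebra ℤ G) : Countable (PrincipalModule f) :=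
  (toPrincipal_surjective f).countable

instance [Countable G] (f : MonoidAlgebra ℤ G) : PolishSpace (XSpace f) :=
  ContinuousAddMonoidHom.isClosedEmbedding_coe.polishSpace

lemma measurable_XSpace_of_eval [Countable G] {f : MonoidAlgebra ℤ G} {Ω : Type*}
    [MeasurableSpace Ω] {π : Ω → XSpace f}
    (h : ∀ a, Measurable fun ω => π ω (toPrincipal f a)) : Measurable π := by
  have hemb : MeasurableEmbedding ((⇑) : XSpace f → PrincipalModule f → UnitAddCircle) :=
    ContinuousAddMonoidHom.isClosedEmbedding_coe.measurableEmbedding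
  rw [← hemb.measurable_comp_iff]
  refine measurable_pi_lambda _ fun q => ?_
  obtain ⟨a, rfl⟩ := toPrincipal_surjective f q
  exact h a

/-- The Haar measure of `X_f` is the only probability measure with vanishing nontrivial Fourier
coefficients. -/
lemma eq_haarX_of_integral_circleChar_eq_zero [Countable G] {f : MonoidAlgebra ℤ G}
    (ν : Measure (XSpace f)) [IsProbabilityMeasure ν]
    (h : ∀ q : PrincipalModule f, q ≠ 0 → ∫ θ, circleChar (θ q) ∂ν = 0) : ν = haarX f := by
  refine ext_of_forall_mem_subalgebra_integral_eq_of_polish (𝕜 := ℂ) (A := trigPoly f) ?_ ?_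
  · intro θ θ' hne
    obtain ⟨q, hq⟩ := DFunLike.ne_iff.1 hne
    exact ⟨_, ⟨_, ⟨dualChar q, Algebra.subset_adjoin ⟨q, rfl⟩, rfl⟩, rfl⟩,
      fun heq => hq (circleChar_injective heq)⟩
  · intro p hp
    have hp' : p ∈ Submodule.span ℂ (Set.range (dualChar (f := f))) := by
      rw [← trigPoly_toSubmodule]
      exact hp
    clear hp
    induction hp' using Submodule.span_induction with
    | mem p hp =>
      obtain ⟨q, rfl⟩ := hp
      simp only [dualChar_apply]
      by_cases hq : q = 0
      · simp [hq]
      · rw [h q hq]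
        -- Nontriviality of the character comes from the hypothesis on `ν`: a character identically
        -- one would have integral one.
        obtain ⟨θ₀, hθ₀⟩ : ∃ θ₀ : XSpace f, circleChar (θ₀ q) ≠ 1 := by
          by_contra hall
          push Not at hall
          have := h q hq
          simp [hall] at this
        -- Translation by `θ₀` multiplies the Haar integral by a scalar different from one, so the
        -- integral is zero.
        have hinv := integral_add_left_eq_self (μ := haarX f) (fun θ => circleChar (θ q)) θ₀
        simp only [ContinuousAddMonoidHom.add_apply, circleChar_add] at hinv
        rw [integral_const_mul] at hinv
        by_contra hne
        exact hθ₀ (mul_right_cancel₀ (Ne.symm hne) (by rw [hinv, one_mul]))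
    | zero => simp
    | add p r _ _ hp hr =>
      simp only [BoundedContinuousFunction.coe_add, Pi.add_apply]
      rw [integral_add (p.integrable ν) (r.integrable ν),
        integral_add (p.integrable _) (r.integrable _), hp, hr]
    | smul c p _ hp =>
      simp only [BoundedContinuousFunction.coe_smul]
      rw [integral_smul, integral_smul, hp]

end XSpace

/-! ### The factor map -/

section Factor

variable {G B : Type*} [MeasurableSpace B]
  {β : Measure B} [IsProbabilityMeasure β] {Y : B → ℤ} {C : ℝ}

lemma exists_tendsto_linStatLp {x : ℕ → MonoidAlgebra ℝ G} {v : lp (fun _ : G => ℝ) 2}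
    (hx : Tendsto (fun N => ell (x N)) atTop (nhds v)) (hY : Measurable Y)
    (hC : ∀ b, |(Y b : ℝ)| ≤ C) (hY0 : ∫ b, (Y b : ℝ) ∂β = 0) :
    ∃ z : Lp ℝ 2 (bernoulliMeasure G β),
      Tendsto (fun N => linStatLp (β := β) hY hC (x N)) atTop (nhds z) := by
  refine cauchySeq_tendsto_of_complete ?_
  have h := cauchySeq_iff_tendsto_dist_atTop_0.1 hx.cauchySeq
  refine cauchySeq_iff_tendsto_dist_atTop_0.2 (squeeze_zero (fun _ => dist_nonneg) (fun n => ?_)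
    (by simpa using h.const_mul |C|))
  rw [dist_eq_norm, dist_eq_norm]
  exact norm_linStatLp_sub_le hY hC hY0 _ _

lemma tendsto_linStatLp_of_tendsto {x : ℕ → MonoidAlgebra ℝ G} {y : MonoidAlgebra ℝ G}
    (hx : Tendsto (fun N => ell (x N)) atTop (nhds (ell y))) (hY : Measurable Y)
    (hC : ∀ b, |(Y b : ℝ)| ≤ C) (hY0 : ∫ b, (Y b : ℝ) ∂β = 0) :
    Tendsto (fun N => linStatLp (β := β) hY hC (x N)) atTop (nhds (linStatLp hY hC y)) := by
  rw [tendsto_iff_norm_sub_tendsto_zero] at hx ⊢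
  exact squeeze_zero (fun _ => norm_nonneg _) (fun n => norm_linStatLp_sub_le hY hC hY0 _ _)
    (by simpa using hx.const_mul |C|)

/-- Convergence in `L²` gives almost sure convergence along a subsequence, and dominated convergence
applies to both sides because characters have modulus one. -/
lemma norm_integral_circleChar_le_of_tendsto {x : ℕ → MonoidAlgebra ℝ G}
    {v : lp (fun _ : G => ℝ) 2} (hx : Tendsto (fun N => ell (x N)) atTop (nhds v))
    (hY : Measurable Y) (hC : ∀ b, |(Y b : ℝ)| ≤ C) {z : Lp ℝ 2 (bernoulliMeasure G β)}
    (hz : Tendsto (fun N => linStatLp (β := β) hY hC (x N)) atTop (nhds z)) (k : G) :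
    ‖∫ ω, circleChar (z ω : UnitAddCircle) ∂(bernoulliMeasure G β)‖ ≤
      ‖∫ b, circleChar ((v k * Y b : ℝ) : UnitAddCircle) ∂β‖ := by
  obtain ⟨ns, hns, hae⟩ := (tendstoInMeasure_of_tendsto_Lp hz).exists_seq_tendsto_ae
  have hcont : Continuous fun t : ℝ => circleChar (t : UnitAddCircle) :=
    continuous_circleChar.comp (AddCircle.continuous_mk' 1)
  have hae' : ∀ᵐ ω ∂(bernoulliMeasure G β), ∀ n,
      linStatLp (β := β) hY hC (x n) ω = linStat Y (x n) ω :=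
    ae_all_iff.2 fun n => (memLp_linStat hY hC (x n)).coeFn_toLp
  have hlim1 : Tendsto (fun n => ∫ ω, circleChar (linStat Y (x (ns n)) ω : UnitAddCircle)
      ∂(bernoulliMeasure G β)) atTop
      (nhds (∫ ω, circleChar (z ω : UnitAddCircle) ∂(bernoulliMeasure G β))) := by
    refine tendsto_integral_of_dominated_convergence (fun _ => 1)
      (fun n => (hcont.measurable.comp (measurable_linStat hY _)).aestronglyMeasurable)
      (integrable_const _) (fun n => Eventually.of_forall fun ω => by simp) ?_
    filter_upwards [hae, hae'] with ω hω hω'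
    simp only [hω'] at hω
    exact (hcont.tendsto _).comp hω
  have hlim2 : Tendsto (fun n => ∫ b, circleChar (((x (ns n)).coeff k * Y b : ℝ) : UnitAddCircle) ∂β)
      atTop (nhds (∫ b, circleChar ((v k * Y b : ℝ) : UnitAddCircle) ∂β)) := by
    refine tendsto_integral_of_dominated_convergence (fun _ => 1)
      (fun n => (hcont.measurable.comp (((measurable_from_top (f := fun n : ℤ => (n : ℝ))).comp
        hY).const_mul _)).aestronglyMeasurable)
      (integrable_const _) (fun n => Eventually.of_forall fun ω => by simp)
      (Eventually.of_forall fun b => ?_)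
    exact (hcont.tendsto _).comp
      (((tendsto_apply_of_tendsto hx k).comp hns.tendsto_atTop).mul_const _)
  exact le_of_tendsto_of_tendsto' hlim1.norm hlim2.norm fun n =>
    norm_integral_circleChar_linStat_le hY _ k

variable [Group G] {f : MonoidAlgebra ℤ G}

/-- A stationary `L²` field over `ℤ(G)` which is additive, takes integer values on `ℤ(G) f`, and
whose Fourier coefficients off `ℤ(G) f` vanish, induces a factor map onto `X_f`. -/
lemma isFactor_of_field [Countable G]
    (z : MonoidAlgebra ℤ G → BernoulliSpace G B → ℝ) (hzm : ∀ a, Measurable (z a))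
    (hadd : ∀ a b, ∀ᵐ ω ∂(bernoulliMeasure G β), z (a + b) ω = z a ω + z b ω)
    (hmul : ∀ a, ∀ᵐ ω ∂(bernoulliMeasure G β), (z (a * f) ω : UnitAddCircle) = 0)
    (hsmul : ∀ (g : G) a, ∀ᵐ ω ∂(bernoulliMeasure G β),
      z a (g • ω) = z (MonoidAlgebra.single g⁻¹ 1 * a) ω)
    (hchar : ∀ a, (∀ b, b * f ≠ a) →
      ∫ ω, circleChar (z a ω : UnitAddCircle) ∂(bernoulliMeasure G β) = 0) :
    IsFactor G (bernoulliMeasure G β) (haarX f) := by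
  classical
  -- Countability of `ℤ(G)` lets all the almost sure identities hold at once on a measurable set of
  -- full measure. Off this set the map takes the value `0`.
  let good : Set (BernoulliSpace G B) :=
    {ω | (∀ a b, z (a + b) ω = z a ω + z b ω) ∧ ∀ a, (z (a * f) ω : UnitAddCircle) = 0}
  have hmk : Measurable fun t : ℝ => (t : UnitAddCircle) := (AddCircle.continuous_mk' 1).measurable
  have hgood : MeasurableSet good := by
    have : good = (⋂ a, ⋂ b, {ω | z (a + b) ω = z a ω + z b ω}) ∩
        ⋂ a, {ω | (z (a * f) ω : UnitAddCircle) = 0} := by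
      ext ω
      simp [good]
    rw [this]
    exact (MeasurableSet.iInter fun a => MeasurableSet.iInter fun b =>
        measurableSet_eq_fun (hzm _) ((hzm a).add (hzm b))).inter
      (MeasurableSet.iInter fun a => measurableSet_eq_fun (hmk.comp (hzm _)) measurable_const)
  have hgood_ae : ∀ᵐ ω ∂(bernoulliMeasure G β), ω ∈ good := by
    filter_upwards [ae_all_iff.2 fun a => ae_all_iff.2 (hadd a), ae_all_iff.2 hmul] with ω h1 h2
    exact ⟨h1, h2⟩
  have hex : ∀ ω, ∃ θ : XSpace f, ∀ a,
      θ (toPrincipal f a) = if ω ∈ good then (z a ω : UnitAddCircle) else 0 := by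
    intro ω
    by_cases hω : ω ∈ good
    · simp only [hω, if_true]
      exact exists_XSpace_of_forall_mul_eq_zero
        (AddMonoidHom.mk' (fun a => (z a ω : UnitAddCircle)) fun a b => by
          rw [hω.1 a b, AddCircle.coe_add]) hω.2
    · simp only [hω, if_false]
      exact ⟨0, fun a => rfl⟩
  choose π hπ using hex
  have hπm : Measurable π := measurable_XSpace_of_eval fun a => by
    simp only [hπ]
    exact Measurable.ite hgood (hmk.comp (hzm a)) measurable_const
  refine ⟨π, ⟨hπm, ?_⟩, fun g => ?_⟩
  · have := Measure.isProbabilityMeasure_map (μ := bernoulliMeasure G β) hπm.aemeasurable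
    refine eq_haarX_of_integral_circleChar_eq_zero _ fun q hq => ?_
    obtain ⟨a, rfl⟩ := toPrincipal_surjective f q
    have hcont : Continuous fun θ : XSpace f => circleChar (θ (toPrincipal f a)) :=
      continuous_circleChar.comp (ContinuousEvalConst.continuous_eval_const _)
    rw [integral_map hπm.aemeasurable hcont.aestronglyMeasurable, ← hchar a fun b hb =>
      hq ((toPrincipal_eq_zero_iff f a).2 ⟨b, hb⟩)]
    refine integral_congr_ae ?_
    filter_upwards [hgood_ae] with ω hω
    rw [hπ, if_pos hω]
  · filter_upwards [hgood_ae, (measurePreserving_smul_bernoulli g).quasiMeasurePreserving.ae hgood_ae,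
      ae_all_iff.2 (hsmul g)] with ω h1 h2 h3
    refine XSpace.ext_toPrincipal fun a => ?_
    rw [smul_apply_toPrincipal, hπ, hπ, if_pos h1, if_pos h2, h3]

theorem isFactorOfBernoulliShift_of_summable [Countable G] [PartialOrder G]
    (hleft : ∀ g x y : G, x ≤ y → g * x ≤ g * y) (hf : IsSemiLopsided f)
    (hpos : ∀ s ∈ offSupport f, 1 < s) (hs : Summable fun n => ‖ell (lazyStep f ^ n)‖) :
    IsFactorOfBernoulliShift G (haarX f) := by
  obtain ⟨M, hM⟩ : ∃ M : ℕ, f.coeff 1 = M := ⟨_, (Int.toNat_of_nonneg hf.1.le).symm⟩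
  have hMpos : 0 < M := by exact_mod_cast hM ▸ hf.1
  obtain ⟨B, _, hB, β, hβ, Y, C, hY, hC, hY0, hvan⟩ := exists_vanishing_distribution M hMpos
  refine ⟨B, inferInstance, hB, β, hβ, ?_⟩
  choose z hz using fun a => exists_tendsto_linStatLp (β := β) (tendsto_ell_greenTrunc hs a) hY hC hY0
  have hadd : ∀ a b, z (a + b) = z a + z b := by
    intro a b
    refine tendsto_nhds_unique (hz _) (((hz a).add (hz b)).congr fun N => ?_)
    rw [linStatLp, linStatLp, ← MemLp.toLp_add]
    refine MemLp.toLp_congr _ _ (Eventually.of_forall fun ω => ?_)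
    rw [greenTrunc_add, linStat_add]
    rfl
  have hmul : ∀ a, z (a * f) = linStatLp hY hC (toReal a) := fun a =>
    tendsto_nhds_unique (hz _)
      (tendsto_linStatLp_of_tendsto (green_mul hf.1 hs a ▸ tendsto_ell_greenTrunc hs (a * f))
        hY hC hY0)
  have hadd_ae : ∀ a b, ∀ᵐ ω ∂(bernoulliMeasure G β), z (a + b) ω = z a ω + z b ω := fun a b => by
    rw [hadd]
    exact Lp.coeFn_add _ _
  have hmul_ae : ∀ a, ∀ᵐ ω ∂(bernoulliMeasure G β), (z (a * f) ω : UnitAddCircle) = 0 := fun a => by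
    rw [hmul]
    filter_upwards [(memLp_linStat hY hC (toReal a)).coeFn_toLp] with ω hω
    obtain ⟨n, hn⟩ := exists_linStat_toReal_eq_intCast Y a ω
    rw [linStatLp, hω, hn, intCast_unitAddCircle_eq_zero]
  refine isFactor_of_field (fun a => z a) (fun a => (Lp.stronglyMeasurable (z a)).measurable)
    hadd_ae hmul_ae (fun g a => ?_) (fun a ha => ?_)
  · have hmp := measurePreserving_smul_bernoulli (β := β) g
    -- Equivariance holds exactly for the truncations and passes to the limit because the shift acts
    -- isometrically on `L²`.
    have h : Lp.compMeasurePreserving _ hmp (z a) = z (MonoidAlgebra.single g⁻¹ 1 * a) := by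
      refine tendsto_nhds_unique
        (((Lp.isometry_compMeasurePreserving hmp).continuous.tendsto _).comp (hz a))
        ((hz _).congr fun N => ?_)
      rw [Function.comp_apply, linStatLp, linStatLp, Lp.toLp_compMeasurePreserving]
      refine MemLp.toLp_congr _ _ (Eventually.of_forall fun ω => ?_)
      rw [greenTrunc_single_mul, Function.comp_apply, linStat_smul]
    rw [← h]
    filter_upwards [Lp.coeFn_compMeasurePreserving (z a) hmp] with ω hω
    rw [hω, Function.comp_apply]
  -- The characteristic function of `Y` vanishes at the coordinate `k`, so the Fourier coefficient
  -- of `a - b * f` is zero. It equals that of `a` because `z (b * f)` is almost surely an integer.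
  · obtain ⟨b, k, m, hm, hne⟩ := exists_green_coeff hleft hf hpos hs a ha
    have hle := norm_integral_circleChar_le_of_tendsto (tendsto_ell_greenTrunc hs (a - b * f)) hY hC
      (hz _) k
    rw [hvan _ ⟨m, by rw [← hm, hM]; simp⟩ hne, norm_zero, norm_le_zero_iff] at hle
    rw [← hle]
    refine integral_congr_ae ?_
    filter_upwards [hadd_ae (a - b * f) (b * f), hmul_ae b] with ω h1 h2
    rw [sub_add_cancel] at h1
    rw [h1, AddCircle.coe_add, h2, add_zero]

end Factor

end AlgebraicAction

theorem corollaryC {G : Type*} [Group G] [Countable G] [PartialOrder G]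
    (hleft : ∀ g x y : G, x ≤ y → g * x ≤ g * y)
    (f : MonoidAlgebra ℤ G) (hf : AlgebraicAction.IsSemiLopsided f)
    (hpos : ∀ s ∈ AlgebraicAction.offSupport f, 1 < s)
    (hinf : Infinite (Subgroup.closure
      {x : G | ∃ a ∈ AlgebraicAction.offSupport f, ∃ b ∈ AlgebraicAction.offSupport f,
        x = a⁻¹ * b}))
    (hcase : AlgebraicAction.IsLopsided f ∨
      AlgebraicAction.HasSuperpolynomialGrowth
        (Subgroup.closure (AlgebraicAction.offSupport f)) ∨
      ∃ d : ℝ, 5 ≤ d ∧ AlgebraicAction.HasPolynomialGrowth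
        (Subgroup.closure (AlgebraicAction.offSupport f)) d) :
    AlgebraicAction.IsFactorOfBernoulliShift G (AlgebraicAction.haarX f) := by
  refine AlgebraicAction.isFactorOfBernoulliShift_of_summable hleft hf hpos ?_
  rcases hcase with h | h | ⟨d, hd, h⟩
  · exact h.summable_norm_lazyStep_pow hf.1
  · exact AlgebraicAction.summable_norm_lazyStep_pow_of_growth hf h.exists_pow_five_le
  · exact AlgebraicAction.summable_norm_lazyStep_pow_of_growth hf (h.exists_pow_five_le hd)
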